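/- Let $x,y\in\{0,1\}^n$, and let $\|x-y\|_1$ denote their Hamming distance. In a randomized two-party protocol Alice holds $x$, Bob holds $y$, and they may use public coins $R$ (a discrete random source, known to both players and independent of the inputs) as well as private coins. For a given value of $R$ the protocol is a finite binary tree: at each inner node one player sends a bit (depending on their own input, on the node and on private coins), and at each leaf one of the players declares the output, depending on their own input, on the leaf and on private coins. Let $\Pi$ be the sequence of bits exchanged. For a distribution $\mu$ of the inputs $(X,Y)$, the internal information cost of a protocol $P$ is $$\mathsf{IC}_\mu(P)=I(\Pi;Y\mid X,R)+I(\Pi;X\mid Y,R),\qquad (X,Y)\sim\mu,$$ measured in bits (equivalently, $R$ is counted as a part of the transcript). Let $\mu_k$ be the distribution of the pair $(x,y)$ where $x$ is uniform on $\{0,1\}^n$ and $y$ is obtained from $x$ by flipping $k$ coordinates chosen independently and uniformly at random, with replacement. **Theorem.** There are absolute constants $c>0$ and $\delta_0>0$ such that the following holds. Let $n,k\ge 1$ be integers and let $0<\delta\le\delta_0$ with $k^2\le\delta n$. Let $P$ be a randomized protocol on inputs from $\{0,1\}^n\times\{0,1\}^n$ that outputs $1$ with probability at least $1-\delta$ on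 every pair $(x,y)$ with $\|x-y\|_1=k$, and outputs $0$ with probability at least $1-\delta$ on every pair $(x,y)$ with $\|x-y\|_1\in\{k-2,k+2\}$ (its answers on all other pairs are arbitrary). Then $$\mathsf{IC}_{\mu_k}(P)\ \ge\ c\,k\log_2\frac{k}{\delta}.$$ -/

import Mathlib

/-- A two-party communication protocol with private coins, as a finite binary protocol tree.
Alice holds an input in `X` and Bob an input in `Y`. At an inner node its owner sends one bit,
which is `true` with the given probability (depending on the owner's input and, through the
node, on all bits exchanged so far), drawn with fresh private randomness. At a leaf the
communication is over, and one of the players, depending on their own input, declares the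
output, which is `true` (that is, `1`) with the given probability. Probabilities `0` and `1`
throughout give deterministic protocols. -/
inductive ProtocolTree (X Y : Type) : Type
  | aliceOutputs (f : X → unitInterval) : ProtocolTree X Y
  | bobOutputs (g : Y → unitInterval) : ProtocolTree X Y
  | aliceSends (p : X → unitInterval) (next : Bool → ProtocolTree X Y) : ProtocolTree X Y
  | bobSends (q : Y → unitInterval) (next : Bool → ProtocolTree X Y) : ProtocolTree X Y

/-- A randomized protocol with public and private coins: a (discrete) distribution on protocol
trees with private coins. The sampled tree is what the public coins determine. -/
abbrev RandomizedProtocol (X Y : Type) : Type := PMF (ProtocolTree X Y)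

/-- A coin that is `true` with probability `p`. -/
noncomputable def biasedCoin (p : unitInterval) : PMF Bool :=
  PMF.ofFintype (fun b => ENNReal.ofReal (cond b (p : ℝ) (1 - p))) (by
    rw [Fintype.sum_bool, cond_true, cond_false,
      ← ENNReal.ofReal_add p.2.1 (sub_nonneg.2 p.2.2), add_sub_cancel, ENNReal.ofReal_one])

/-- The joint distribution of the transcript (the sequence of bits exchanged) and the output
of a protocol tree on the inputs `x`, `y`. -/
noncomputable def ProtocolTree.run {X Y : Type} :
    ProtocolTree X Y → X → Y → PMF (List Bool × Bool)
  | .aliceOutputs f, x, _ => (biasedCoin (f x)).map fun o => ([], o)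
  | .bobOutputs g, _, y => (biasedCoin (g y)).map fun o => ([], o)
  | .aliceSends p next, x, y =>
      (biasedCoin (p x)).bind fun b => ((next b).run x y).map fun t => (b :: t.1, t.2)
  | .bobSends q next, x, y =>
      (biasedCoin (q y)).bind fun b => ((next b).run x y).map fun t => (b :: t.1, t.2)

/-- The distribution of the output of a randomized protocol on the inputs `x`, `y`, over the
public and the private coins. -/
noncomputable def RandomizedProtocol.output {X Y : Type} (P : RandomizedProtocol X Y)
    (x : X) (y : Y) : PMF Bool :=
  P.bind fun T => (T.run x y).map Prod.snd

/-- The conditional mutual information `I(A ; B | C)`, in bits, of jointly distributed discrete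
random variables `(A, B, C)` with joint law `P`: the expectation of
`log₂ (ℙ(A,B|C) / (ℙ(A|C) ℙ(B|C)))`. -/
noncomputable def condMutualInfo {α β γ : Type} (P : PMF (α × β × γ)) : ℝ :=
  ∑' t : α × β × γ, (P t).toReal *
    Real.logb 2
      (((P t).toReal / ((P.map fun s => s.2.2) t.2.2).toReal) /
        ((((P.map fun s => (s.1, s.2.2)) (t.1, t.2.2)).toReal /
            ((P.map fun s => s.2.2) t.2.2).toReal) *
          (((P.map fun s => s.2) t.2).toReal / ((P.map fun s => s.2.2) t.2.2).toReal)))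

/-- The joint law of `(X, Y, Π)`, where the inputs `(X, Y)` are drawn from `μ` and `Π` is the
transcript of the protocol tree `T` on these inputs. -/
noncomputable def ProtocolTree.jointLaw {X Y : Type} (T : ProtocolTree X Y) (μ : PMF (X × Y)) :
    PMF (X × Y × List Bool) :=
  μ.bind fun z => (T.run z.1 z.2).map fun t => (z.1, z.2, t.1)

/-- The internal information cost `I(Π ; Y | X) + I(Π ; X | Y)` of a protocol tree. -/
noncomputable def ProtocolTree.infoCost {X Y : Type} (T : ProtocolTree X Y) (μ : PMF (X × Y)) :
    ℝ :=
  condMutualInfo ((T.jointLaw μ).map fun s => (s.2.2, s.2.1, s.1)) +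
    condMutualInfo ((T.jointLaw μ).map fun s => (s.2.2, s.1, s.2.1))

/-- The internal information cost of a randomized protocol. The public coins `R` are known to
both players and independent of the inputs, and the information is measured given `R`: this
is `I(Π ; Y | X, R) + I(Π ; X | Y, R)`, the expectation over the value of `R` of the cost of
the tree that it determines (equivalently, `R` is made a part of the transcript). -/
noncomputable def RandomizedProtocol.infoCost {X Y : Type} (P : RandomizedProtocol X Y)
    (μ : PMF (X × Y)) : ℝ :=
  ∑' T : ProtocolTree X Y, (P T).toReal * T.infoCost μ

/-- Flip the coordinates `i 0, …, i (k - 1)` of `x` one after the other: coordinate `j` is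
reversed if and only if it occurs an odd number of times. -/
def flipCoords {n k : ℕ} (x : Fin n → Bool) (i : Fin k → Fin n) : Fin n → Bool :=
  fun j => xor (x j) (decide (Odd (Finset.univ.filter fun t => i t = j).card))

/-- The distribution `μ_k` on pairs `(x, y)` of `n`-bit strings: `x` is uniform, and `y` is
obtained from `x` by flipping `k` coordinates chosen independently and uniformly at random,
with replacement. -/
noncomputable def walkPair (n k : ℕ) [NeZero n] : PMF ((Fin n → Bool) × (Fin n → Bool)) :=
  (PMF.uniformOfFintype (Fin n → Bool)).bind fun x =>
    (PMF.uniformOfFintype (Fin k → Fin n)).map fun i => (x, flipCoords x i)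

/-! By the rectangle property, a transcript together with output 1 is a pair of weights `f` on
Alice's and `g` on Bob's inputs. If the inputs are the ends of a `j`-step walk on the cube with
transition matrix `S`, its mass is `m_j = ⟨f, S ^ j g⟩`, up to the factor `2 ^ (-n)`. Since `k² ≤ δ
n`, walks of length `k` and `k ± 2` flip distinct coordinates except with probability `O(δ)`.
Correctness therefore makes the total mass of output 1 close to 1 for length `k` and `O(δ)` for
lengths `k ± 2`. So most mass lies on leaves with `m_{k±2} ≤ 100 δ m_k`, and it is enough that such
a leaf reveals order `m_k k log (k / δ)` (`IsSymmStochastic.leaf_bound`).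

For one leaf, put `u j = S ^ j f` and `v j = S ^ j g`, the messages of the `k`-step walk weighted by
`f` and `g` at its ends. The information of the leaf is an increment `E_k - E_0` of
`messageEntropy`, which telescopes over the steps. For `i < k`, build a walk of `k + 2` steps:
follow the weighted walk to time `i + 1`, step back to time `i` by its conditional law, and continue
afresh from there. Relative to the weighted measure on all `(k + 2)`-step walks, the entropy of this
law is `-log m_k + (E_{i+1} - E_i) / m_k`.

The reference measure has total mass `m_{k+2}`, so every mixture of these laws has entropy at least
`-log m_{k+2}`; this yields `log (m_k / m_{k+2})`, hence about `log (1 / δ)`, per step. The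
remaining `log k` comes from the mixture: laws with different `i` are almost singular to each other,
because at a time between two insertions one walk is already delayed by two steps and the other is
not. Cauchy–Schwarz bounds the overlap of the two marginals by `√(m_{k+2} m_{k-2}) / m_k ≤ 100 δ`.
Averaging `2 ^ r` laws by repeated halving thus loses almost `r log 2` of entropy
(`entropy_dyadicMean_le`). With `k / 2 < 2 ^ r ≤ k`, summing over the insertions gives
`HeatPair.le_messageEntropy_sub`. -/

namespace InfoCost

/-! ### Path sums -/

section Paths
variable {V : Type*}

/-- The weight of a path with initial weight `f`, transition weights `K` and final weight `g`. -/
noncomputable def pathWeight (n : ℕ) (K : ℕ → V → V → ℝ) (f g : V → ℝ) (w : Fin (n + 1) → V) : ℝ :=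
  f (w 0) * (∏ t : Fin n, K t (w t.castSucc) (w t.succ)) * g (w (Fin.last n))

theorem sum_fin_cons [Fintype V] {n : ℕ} (F : (Fin (n + 1) → V) → ℝ) :
    ∑ w, F w = ∑ x, ∑ w : Fin n → V, F (Fin.cons x w) := by
  rw [← (Fin.consEquiv fun _ => V).sum_comp, Fintype.sum_prod_type]
  rfl

theorem pathWeight_cons (n : ℕ) (K : ℕ → V → V → ℝ) (f g : V → ℝ) (x : V) (w : Fin (n + 1) → V) :
    pathWeight (n + 1) K f g (Fin.cons x w) =
      f x * K 0 x (w 0) *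
        (∏ t : Fin n, K (t + 1) (w t.castSucc) (w t.succ)) * g (w (Fin.last n)) := by
  have h : ∀ t : Fin n, (Fin.cons x w : Fin (n + 2) → V) t.succ.castSucc = w t.castSucc := by
    intro t
    rw [← Fin.succ_castSucc, Fin.cons_succ]
  simp only [pathWeight, Fin.prod_univ_succ, Fin.cons_zero, Fin.cons_succ, Fin.castSucc_zero, h,
    ← Fin.succ_last, Fin.val_zero, Fin.val_succ]
  ring

variable [Fintype V]

theorem sum_pathWeight_cons_mul (n : ℕ) (K : ℕ → V → V → ℝ) (f g : V → ℝ)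
    (h : (Fin (n + 1) → V) → ℝ) :
    ∑ x, ∑ w : Fin (n + 1) → V, pathWeight (n + 1) K f g (Fin.cons x w) * h w =
      ∑ w, pathWeight n (fun t => K (t + 1)) (fun y => ∑ x, f x * K 0 x y) g w * h w := by
  rw [Finset.sum_comm]
  refine Finset.sum_congr rfl fun w _ => ?_
  simp only [pathWeight_cons]
  simp only [pathWeight, Finset.sum_mul]

theorem sum_pathWeight (n : ℕ) (K : ℕ → V → V → ℝ) (f : V → ℝ) (B : ℕ → V → ℝ)
    (hB : ∀ t < n, ∀ x, B t x = ∑ y, K t x y * B (t + 1) y) :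
    ∑ w, pathWeight n K f (B n) w = ∑ x, f x * B 0 x := by
  induction n generalizing K f B with
  | zero =>
    rw [← (Equiv.funUnique (Fin 1) V).symm.sum_comp]
    simp [pathWeight]
  | succ n ih =>
    have h := sum_pathWeight_cons_mul n K f (B (n + 1)) fun _ => 1
    simp only [mul_one] at h
    rw [sum_fin_cons, h, ih _ _ (fun t => B (t + 1)) fun t ht x => hB (t + 1) (by omega) x]
    simp only [Finset.sum_mul]
    rw [Finset.sum_comm]
    refine Finset.sum_congr rfl fun x _ => ?_
    rw [hB 0 (by omega) x, Finset.mul_sum]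
    refine Finset.sum_congr rfl fun y _ => by simp only [zero_add]; ring

/-- The marginal of a path measure at one time is the product of the forward and the backward
messages. -/
theorem sum_pathWeight_mul (n : ℕ) (K : ℕ → V → V → ℝ) (A B : ℕ → V → ℝ)
    (hA : ∀ t < n, ∀ y, A (t + 1) y = ∑ x, A t x * K t x y)
    (hB : ∀ t < n, ∀ x, B t x = ∑ y, K t x y * B (t + 1) y) (t : Fin (n + 1)) (h : V → ℝ) :
    ∑ w, pathWeight n K (A 0) (B n) w * h (w t) = ∑ x, A t x * B t x * h x := by
  induction n generalizing K A B with
  | zero =>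
    obtain rfl : t = 0 := Fin.ext (by omega)
    rw [← (Equiv.funUnique (Fin 1) V).symm.sum_comp]
    simp [pathWeight]
  | succ n ih =>
    refine Fin.cases ?_ (fun t => ?_) t
    · have := sum_pathWeight (n + 1) K (fun x => A 0 x * h x) B hB
      simp only [Fin.val_zero]
      rw [Finset.sum_congr rfl fun x _ => mul_right_comm (A 0 x) (B 0 x) (h x), ← this]
      refine Finset.sum_congr rfl fun w _ => ?_
      simp only [pathWeight]
      ring
    · have h1 := sum_pathWeight_cons_mul n K (A 0) (B (n + 1)) fun w => h (w t)
      rw [sum_fin_cons]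
      simp only [Fin.cons_succ, Fin.val_succ]
      rw [h1, ← ih (fun t => K (t + 1)) (fun t => A (t + 1)) (fun t => B (t + 1))
        (fun t ht => hA (t + 1) (by omega)) (fun t ht => hB (t + 1) (by omega)) t]
      simp only [funext (hA 0 (by omega)), zero_add]

end Paths

/-! ### Entropy of mixtures -/

section Mixtures

/-- Write the logarithm as twice that of the square root, then use `log t ≤ t - 1` and `√(a + b) ≤
√a + √b`. -/
theorem mul_log_div_le {a b : ℝ} (ha : 0 < a) (hb : 0 < b) :
    a * Real.log ((a + b) / a) ≤ 2 * √(a * b) := by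
  have hs : 0 < a + b := by positivity
  have h1 : Real.log ((a + b) / a) = 2 * Real.log (√(a + b) / √a) := by
    rw [← Real.sqrt_div hs.le, Real.log_sqrt (by positivity)]
    ring
  have h2 := Real.log_le_sub_one_of_pos (x := √(a + b) / √a) (by positivity)
  have h3 : √(a + b) ≤ √a + √b := by
    rw [Real.sqrt_le_left (by positivity), add_sq, Real.sq_sqrt ha.le, Real.sq_sqrt hb.le]
    have : 0 ≤ √a * √b := by positivity
    linarith
  have h4 : a * (√(a + b) / √a - 1) ≤ √a * √b := by
    have h5 : a * (√(a + b) / √a - 1) = √a * (√(a + b) - √a) := by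
      have h6 : √a * √a = a := Real.mul_self_sqrt ha.le
      field_simp
      rw [Real.sq_sqrt ha.le]
    rw [h5]
    gcongr
    linarith
  rw [h1, Real.sqrt_mul ha.le]
  nlinarith

/-- The Jensen gap of `t log t` at a midpoint would be the full `log 2` times the mass for
disjointly supported densities; the term `√(a * b)` pays for their overlap. -/
theorem mul_log_midpoint_le {a b : ℝ} (ha : 0 < a) (hb : 0 < b) :
    (a + b) / 2 * Real.log ((a + b) / 2) ≤
      (a * Real.log a + b * Real.log b) / 2 - (Real.log 2 * ((a + b) / 2) - 2 * √(a * b)) := by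
  have h1 := mul_log_div_le ha hb
  have h2 := mul_log_div_le hb ha
  rw [Real.log_div (by positivity) ha.ne'] at h1
  rw [Real.log_div (by positivity) hb.ne', add_comm b a, mul_comm b a] at h2
  rw [Real.log_div (by positivity) two_ne_zero]
  linarith

variable {Ω V : Type*}

/-- Cauchy–Schwarz on each fibre of `τ`: overlap can only grow under a projection, so it may be
bounded on a single marginal. -/
theorem sum_sqrt_mul_le_of_marginals [Fintype Ω] [Fintype V] [DecidableEq V]
    {R p q : Ω → ℝ} (hR : ∀ w, 0 ≤ R w) (hp : ∀ w, 0 ≤ p w)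
    (hq : ∀ w, 0 ≤ q w) (τ : Ω → V) {P Q : V → ℝ}
    (hP : ∀ x, ∑ w with τ w = x, R w * p w = P x)
    (hQ : ∀ x, ∑ w with τ w = x, R w * q w = Q x) :
    ∑ w, R w * √(p w * q w) ≤ ∑ x, √(P x * Q x) := by
  rw [← Finset.sum_fiberwise Finset.univ τ]
  refine Finset.sum_le_sum fun x _ => ?_
  have hP0 : 0 ≤ P x := by
    rw [← hP]
    exact Finset.sum_nonneg fun w _ => mul_nonneg (hR w) (hp w)
  calc ∑ w with τ w = x, R w * √(p w * q w)
      = ∑ w with τ w = x, √(R w * p w) * √(R w * q w) := by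
        refine Finset.sum_congr rfl fun w _ => ?_
        rw [← Real.sqrt_mul (mul_nonneg (hR w) (hp w)),
          show R w * p w * (R w * q w) = R w ^ 2 * (p w * q w) by ring,
          Real.sqrt_mul (sq_nonneg _), Real.sqrt_sq (hR w)]
    _ ≤ √(∑ w with τ w = x, R w * p w) * √(∑ w with τ w = x, R w * q w) :=
        Real.sum_sqrt_mul_sqrt_le _ (fun w => mul_nonneg (hR w) (hp w))
          fun w => mul_nonneg (hR w) (hq w)
    _ = √(P x * Q x) := by rw [hP, hQ, ← Real.sqrt_mul hP0]

/-- The average of `2 ^ r` consecutive densities. -/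
noncomputable def dyadicMean (ψ : ℕ → Ω → ℝ) (a r : ℕ) (w : Ω) : ℝ :=
  (∑ i ∈ Finset.range (2 ^ r), ψ (a + i) w) / 2 ^ r

theorem dyadicMean_succ (ψ : ℕ → Ω → ℝ) (a r : ℕ) (w : Ω) :
    dyadicMean ψ a (r + 1) w = (dyadicMean ψ a r w + dyadicMean ψ (a + 2 ^ r) r w) / 2 := by
  simp only [dyadicMean, pow_succ, mul_two, Finset.sum_range_add, add_assoc]
  field_simp
  ring

theorem dyadicMean_pos {ψ : ℕ → Ω → ℝ} (hψ : ∀ i w, 0 < ψ i w) (a r : ℕ) (w : Ω) :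
    0 < dyadicMean ψ a r w :=
  div_pos (Finset.sum_pos (fun i _ => hψ _ w) ⟨0, by simp⟩) (by positivity)

theorem sum_mul_dyadicMean {s : Finset Ω} {R : Ω → ℝ} {ψ : ℕ → Ω → ℝ} {a r : ℕ} {c : ℝ}
    (h : ∀ i, a ≤ i → i < a + 2 ^ r → ∑ w ∈ s, R w * ψ i w = c) :
    ∑ w ∈ s, R w * dyadicMean ψ a r w = c := by
  simp only [dyadicMean, mul_div_assoc', ← Finset.sum_div, Finset.mul_sum]
  rw [Finset.sum_comm, Finset.sum_congr rfl fun i hi =>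
    h (a + i) (by omega) (by have := Finset.mem_range.1 hi; omega)]
  simp

/-- If densities can be told apart by thresholds, then mixing `2 ^ r` of them lowers the relative
entropy by a multiple of `r`. -/
theorem entropy_dyadicMean_le [Fintype Ω] [Fintype V] [DecidableEq V]
    {k : ℕ} {R : Ω → ℝ} (hR : ∀ w, 0 ≤ R w) {ψ : ℕ → Ω → ℝ}
    (hψ : ∀ i w, 0 < ψ i w) (hmass : ∀ i < k, ∑ w, R w * ψ i w = 1) {ε : ℝ}
    (hsep : ∀ mid, 0 < mid → mid < k → ∃ (τ : Ω → V) (P Q : V → ℝ),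
      (∀ i < mid, ∀ x, ∑ w with τ w = x, R w * ψ i w = P x) ∧
      (∀ i, mid ≤ i → i < k → ∀ x, ∑ w with τ w = x, R w * ψ i w = Q x) ∧
      ∑ x, √(P x * Q x) ≤ ε) (r : ℕ) :
    ∀ a, a + 2 ^ r ≤ k →
      ∑ w, R w * (dyadicMean ψ a r w * Real.log (dyadicMean ψ a r w)) ≤
        (∑ i ∈ Finset.range (2 ^ r), ∑ w, R w * (ψ (a + i) w * Real.log (ψ (a + i) w))) / 2 ^ r -
          r * (Real.log 2 - 2 * ε) := by
  induction r with
  | zero => intro a ha; simp [dyadicMean]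
  | succ r ih =>
    intro a ha
    have hr : 0 < 2 ^ r := by positivity
    rw [pow_succ] at ha
    have h1 := ih a (by omega)
    have h2 := ih (a + 2 ^ r) (by omega)
    -- The threshold separates the two halves being averaged. Densities on the same side share their
    -- marginal, so the mean of each half has that marginal too.
    obtain ⟨τ, P, Q, hP, hQ, hPQ⟩ := hsep (a + 2 ^ r) (by omega) (by omega)
    have h3 := sum_sqrt_mul_le_of_marginals hR (fun w => (dyadicMean_pos hψ a r w).le)
      (fun w => (dyadicMean_pos hψ (a + 2 ^ r) r w).le) τ
      (fun x => sum_mul_dyadicMean fun i _ hi => hP i hi x)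
      (fun x => sum_mul_dyadicMean fun i hi hi' => hQ i hi (by omega) x)
    have m1 : ∑ w, R w * dyadicMean ψ a r w = 1 :=
      sum_mul_dyadicMean fun i _ hi => hmass i (by omega)
    have m2 : ∑ w, R w * dyadicMean ψ (a + 2 ^ r) r w = 1 :=
      sum_mul_dyadicMean fun i _ hi => hmass i (by omega)
    have h4 := Finset.sum_le_sum fun w (_ : w ∈ Finset.univ) =>
      mul_le_mul_of_nonneg_left (mul_log_midpoint_le (dyadicMean_pos hψ a r w)
        (dyadicMean_pos hψ (a + 2 ^ r) r w)) (hR w)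
    have h5 : ∑ w, R w * ((dyadicMean ψ a r w * Real.log (dyadicMean ψ a r w) +
          dyadicMean ψ (a + 2 ^ r) r w * Real.log (dyadicMean ψ (a + 2 ^ r) r w)) / 2 -
        (Real.log 2 * ((dyadicMean ψ a r w + dyadicMean ψ (a + 2 ^ r) r w) / 2) -
          2 * √(dyadicMean ψ a r w * dyadicMean ψ (a + 2 ^ r) r w))) =
        (∑ w, R w * (dyadicMean ψ a r w * Real.log (dyadicMean ψ a r w)) +
          ∑ w, R w * (dyadicMean ψ (a + 2 ^ r) r w *
            Real.log (dyadicMean ψ (a + 2 ^ r) r w))) / 2 -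
        (Real.log 2 * ((∑ w, R w * dyadicMean ψ a r w +
            ∑ w, R w * dyadicMean ψ (a + 2 ^ r) r w) / 2) -
          2 * ∑ w, R w * √(dyadicMean ψ a r w * dyadicMean ψ (a + 2 ^ r) r w)) := by
      simp only [← Finset.sum_add_distrib, Finset.sum_div, Finset.mul_sum, ← Finset.sum_sub_distrib]
      exact Finset.sum_congr rfl fun w _ => by ring
    rw [h5, m1, m2] at h4
    simp only [dyadicMean_succ]
    have h6 : (∑ i ∈ Finset.range (2 ^ (r + 1)),
          ∑ w, R w * (ψ (a + i) w * Real.log (ψ (a + i) w))) / 2 ^ (r + 1) =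
        ((∑ i ∈ Finset.range (2 ^ r), ∑ w, R w * (ψ (a + i) w * Real.log (ψ (a + i) w))) / 2 ^ r +
        (∑ i ∈ Finset.range (2 ^ r),
          ∑ w, R w * (ψ (a + 2 ^ r + i) w * Real.log (ψ (a + 2 ^ r + i) w))) / 2 ^ r) / 2 := by
      simp only [pow_succ, mul_two, Finset.sum_range_add, add_assoc]
      field_simp
      ring
    rw [h6]
    push_cast
    linarith

/-- Gibbs' inequality against the normalized measure `R / m`, obtained pointwise from `log t ≤ t -
1` at `t = m⁻¹ / p w`. -/
theorem neg_log_sum_le_entropy [Fintype Ω] {R p : Ω → ℝ} (hR : ∀ w, 0 ≤ R w) (hp : ∀ w, 0 < p w)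
    (hmass : ∑ w, R w * p w = 1) (hpos : 0 < ∑ w, R w) :
    -Real.log (∑ w, R w) ≤ ∑ w, R w * (p w * Real.log (p w)) := by
  set m := ∑ w, R w with hm
  have h : ∀ w, R w * p w * (-Real.log m) + R w * p w - R w * m⁻¹ ≤
      R w * (p w * Real.log (p w)) := by
    intro w
    have h1 := Real.log_le_sub_one_of_pos (x := m⁻¹ / p w) (by have := hp w; positivity)
    rw [Real.log_div (by positivity) (hp w).ne', Real.log_inv] at h1
    have h2 : p w * (m⁻¹ / p w) = m⁻¹ := mul_div_cancel₀ _ (hp w).ne'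
    have h3 : p w * (-Real.log m) + p w - m⁻¹ ≤ p w * Real.log (p w) := by
      nlinarith [hp w]
    calc _ = R w * (p w * (-Real.log m) + p w - m⁻¹) := by ring
      _ ≤ _ := mul_le_mul_of_nonneg_left h3 (hR w)
  have h4 := Finset.sum_le_sum fun w (_ : w ∈ Finset.univ) => h w
  rw [Finset.sum_sub_distrib, Finset.sum_add_distrib, ← Finset.sum_mul, ← Finset.sum_mul, hmass,
    ← hm, mul_inv_cancel₀ hpos.ne'] at h4
  linarith

end Mixtures

/-! ### Inserting two steps into a walk -/

section Insertion
variable {V : Type*}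

/-- Two positive functions evolving under the same symmetric stochastic kernel. -/
structure HeatPair [Fintype V] (S : V → V → ℝ) (u v : ℕ → V → ℝ) : Prop where
  nonneg : ∀ x y, 0 ≤ S x y
  symm : ∀ x y, S x y = S y x
  sum_eq_one : ∀ x, ∑ y, S x y = 1
  left_pos : ∀ j x, 0 < u j x
  right_pos : ∀ j x, 0 < v j x
  left_succ : ∀ j x, u (j + 1) x = ∑ y, S x y * u j y
  right_succ : ∀ j x, v (j + 1) x = ∑ y, S x y * v j y

/-- The factor by which the weight of a walk changes when the step `i` is repeated backwards and
forwards, the new pair of vertices being `a`, `b`. -/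
noncomputable def insertionRatio (k : ℕ) (u v : ℕ → V → ℝ) (m : ℝ) (i : ℕ) (a b : V) : ℝ :=
  v (k - (i + 1)) a * u i b / (u (i + 1) a * v (k - i) b * m)

/-- The whole density is placed on one transition, so the modified path measure is still Markov and
`sum_pathWeight_mul` computes its marginals. -/
noncomputable def insertionKernel (S : V → V → ℝ) (k : ℕ) (u v : ℕ → V → ℝ) (m : ℝ) (i t : ℕ)
    (a b : V) : ℝ :=
  S a b * if t = i + 1 then insertionRatio k u v m i a b else 1

/-- The density, relative to the walks of length `k + 2`, of the walk of length `k` with its step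
`i` repeated backwards and forwards. -/
noncomputable def insertionDensity (k : ℕ) (u v : ℕ → V → ℝ) (m : ℝ) (i : ℕ)
    (w : Fin (k + 2 + 1) → V) : ℝ :=
  insertionRatio k u v m i (w (Fin.ofNat _ (i + 1))) (w (Fin.ofNat _ (i + 2)))

theorem pathWeight_insertionKernel (S : V → V → ℝ) {k : ℕ} (u v : ℕ → V → ℝ) (m : ℝ) {i : ℕ}
    (hi : i < k) (f g : V → ℝ) (w : Fin (k + 2 + 1) → V) :
    pathWeight (k + 2) (insertionKernel S k u v m i) f g w =
      pathWeight (k + 2) (fun _ => S) f g w * insertionDensity k u v m i w := by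
  have h : ∏ t : Fin (k + 2), (if (t : ℕ) = i + 1 then
      insertionRatio k u v m i (w t.castSucc) (w t.succ) else 1) = insertionDensity k u v m i w := by
    rw [Finset.prod_eq_single (⟨i + 1, by omega⟩ : Fin (k + 2))]
    · rw [if_pos rfl, insertionDensity]
      congr 2
      · refine Fin.ext ?_
        simp [Fin.ofNat, Nat.mod_eq_of_lt (show i + 1 < k + 2 + 1 by omega)]
      · refine Fin.ext ?_
        simp [Fin.ofNat, Nat.mod_eq_of_lt (show i + 2 < k + 2 + 1 by omega)]
    · intro t _ ht
      exact if_neg fun h => ht (Fin.ext h)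
    · simp
  rw [← h]
  simp only [pathWeight, insertionKernel, Finset.prod_mul_distrib]
  ring

variable [Fintype V] {S : V → V → ℝ} {u v : ℕ → V → ℝ}

theorem HeatPair.sum_succ_mul (H : HeatPair S u v) (f g : V → ℝ) :
    ∑ x, (∑ y, S x y * f y) * g x = ∑ x, f x * ∑ y, S x y * g y := by
  simp only [Finset.sum_mul, Finset.mul_sum]
  rw [Finset.sum_comm]
  refine Finset.sum_congr rfl fun x _ => Finset.sum_congr rfl fun y _ => ?_
  rw [H.symm y x]
  ring

theorem HeatPair.sum_mul_eq (H : HeatPair S u v) (i j : ℕ) :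
    ∑ x, u i x * v j x = ∑ x, u 0 x * v (i + j) x := by
  induction i generalizing j with
  | zero => simp
  | succ i ih =>
    rw [show i + 1 + j = i + (j + 1) by ring, ← ih]
    simp only [H.left_succ, H.right_succ]
    exact H.sum_succ_mul _ _

theorem HeatPair.sum_mul_pos [Nonempty V] (H : HeatPair S u v) (i j : ℕ) :
    0 < ∑ x, u i x * v j x :=
  Finset.sum_pos (fun x _ => mul_pos (H.left_pos i x) (H.right_pos j x)) Finset.univ_nonempty

theorem HeatPair.insertionDensity_pos (H : HeatPair S u v) {k : ℕ} {m : ℝ} (hm : 0 < m) (i : ℕ)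
    (w : Fin (k + 2 + 1) → V) : 0 < insertionDensity k u v m i w := by
  have h1 := H.left_pos
  have h2 := H.right_pos
  rw [insertionDensity, insertionRatio]
  exact div_pos (mul_pos (h2 _ _) (h1 _ _)) (mul_pos (mul_pos (h1 _ _) (h2 _ _)) hm)

/-- The messages of the modified kernel are explicit: up to time `i + 1` the law looks like the
`k`-step walk, afterwards like that walk delayed by two steps. -/
theorem HeatPair.sum_mul_insertionDensity_mul (H : HeatPair S u v) {k : ℕ} {m : ℝ} (hm : 0 < m)
    {i : ℕ} (hi : i < k) (t : Fin (k + 2 + 1)) (h : V → ℝ) :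
    ∑ w, pathWeight (k + 2) (fun _ => S) (u 0) (v 0) w * insertionDensity k u v m i w * h (w t) =
      ∑ x, (if (t : ℕ) ≤ i + 1 then u t x * v (k - t) x else u (t - 2) x * v (k + 2 - t) x) / m *
        h x := by
  -- The factor `1 / m` sits in the backward message before the insertion and in the forward message
  -- after it, so the end weights remain `u 0` and `v 0`.
  have key := sum_pathWeight_mul (k + 2) (insertionKernel S k u v m i)
    (fun t x => if t ≤ i + 1 then u t x else u (t - 2) x / m)
    (fun t x => if t ≤ i + 1 then v (k - t) x / m else v (k + 2 - t) x) ?_ ?_ t h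
  · have e : ¬ (k + 2 ≤ i + 1) := by omega
    simp only [Nat.zero_le, if_true, e, if_false, Nat.sub_self] at key
    simp only [pathWeight_insertionKernel S u v m hi] at key
    rw [key]
    refine Finset.sum_congr rfl fun x _ => ?_
    split_ifs <;> ring
  · intro t ht y
    rcases lt_trichotomy t (i + 1) with h1 | h1 | h1
    · rw [if_pos (by omega), H.left_succ]
      refine Finset.sum_congr rfl fun x _ => ?_
      rw [if_pos (by omega), insertionKernel, if_neg (by omega), H.symm]
      ring
    · subst h1
      rw [if_neg (by omega)]
      have h2 : ∀ x, (if i + 1 ≤ i + 1 then u (i + 1) x else u (i + 1 - 2) x / m) *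
          insertionKernel S k u v m i (i + 1) x y =
          S y x * v (k - (i + 1)) x * (u i y / (v (k - i) y * m)) := by
        intro x
        rw [if_pos le_rfl, insertionKernel, if_pos rfl, insertionRatio, H.symm]
        have := (H.left_pos (i + 1) x).ne'
        have := (H.right_pos (k - i) y).ne'
        field_simp
      rw [Finset.sum_congr rfl fun x _ => h2 x, ← Finset.sum_mul, ← H.right_succ,
        show k - (i + 1) + 1 = k - i by omega, show i + 1 + 1 - 2 = i by omega]
      have := (H.right_pos (k - i) y).ne'
      field_simp
    · rw [if_neg (by omega), show t + 1 - 2 = t - 2 + 1 by omega, H.left_succ, Finset.sum_div]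
      refine Finset.sum_congr rfl fun x _ => ?_
      rw [if_neg (by omega), insertionKernel, if_neg (by omega), H.symm]
      ring
  · intro t ht x
    rcases lt_trichotomy t (i + 1) with h1 | h1 | h1
    · rw [if_pos (by omega), show k - t = k - (t + 1) + 1 by omega, H.right_succ, Finset.sum_div]
      refine Finset.sum_congr rfl fun y _ => ?_
      rw [if_pos (by omega), insertionKernel, if_neg (by omega)]
      ring
    · subst h1
      rw [if_pos le_rfl]
      have h2 : ∀ y, insertionKernel S k u v m i (i + 1) x y *
          (if i + 1 + 1 ≤ i + 1 then v (k - (i + 1 + 1)) y / m else v (k + 2 - (i + 1 + 1)) y) =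
          S x y * u i y * (v (k - (i + 1)) x / (u (i + 1) x * m)) := by
        intro y
        rw [if_neg (by omega), insertionKernel, if_pos rfl, insertionRatio,
          show k + 2 - (i + 1 + 1) = k - i by omega]
        have := (H.left_pos (i + 1) x).ne'
        have := (H.right_pos (k - i) y).ne'
        field_simp
      rw [Finset.sum_congr rfl fun y _ => h2 y, ← Finset.sum_mul, ← H.left_succ]
      have := (H.left_pos (i + 1) x).ne'
      field_simp
    · rw [if_neg (by omega), show k + 2 - t = k + 2 - (t + 1) + 1 by omega, H.right_succ]
      refine Finset.sum_congr rfl fun y _ => ?_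
      rw [if_neg (by omega), insertionKernel, if_neg (by omega)]
      ring

/-- The mean log-ratio of the backward and the forward message at time `j`. -/
noncomputable def messageEntropy (k : ℕ) (u v : ℕ → V → ℝ) (j : ℕ) : ℝ :=
  ∑ x, u j x * v (k - j) x * (Real.log (v (k - j) x) - Real.log (u j x))

theorem HeatPair.mul_log_le (H : HeatPair S u v) {f : V → ℝ} (hf : ∀ x, 0 ≤ f x) (x : V) :
    (∑ y, S x y * f y) * Real.log (∑ y, S x y * f y) ≤ ∑ y, S x y * (f y * Real.log (f y)) := by
  have := Real.convexOn_mul_log.map_sum_le (t := Finset.univ) (w := fun y => S x y) (p := f)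
    (fun y _ => H.nonneg x y) (H.sum_eq_one x) fun y _ => hf y
  simpa [smul_eq_mul] using this

/-- The increment is a sum of two Jensen gaps of `t log t` under `S`, one for `v` and one for `u`.
-/
theorem HeatPair.messageEntropy_le_succ (H : HeatPair S u v) {k i : ℕ} (hi : i < k) :
    messageEntropy k u v i ≤ messageEntropy k u v (i + 1) := by
  have e : k - i = k - (i + 1) + 1 := by omega
  rw [messageEntropy, messageEntropy, e]
  generalize k - (i + 1) = j
  have h1 : ∑ x, u (i + 1) x * (v j x * Real.log (v j x)) -
      ∑ x, u i x * (v (j + 1) x * Real.log (v (j + 1) x)) ≥ 0 := by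
    simp only [H.left_succ, H.right_succ]
    rw [H.sum_succ_mul (u i) fun x => v j x * Real.log (v j x), ← Finset.sum_sub_distrib]
    refine Finset.sum_nonneg fun x _ => ?_
    rw [← mul_sub]
    exact mul_nonneg (H.left_pos i x).le
      (sub_nonneg.2 (H.mul_log_le (fun y => (H.right_pos j y).le) x))
  have h2 : ∑ x, (u i x * Real.log (u i x)) * v (j + 1) x -
      ∑ x, (u (i + 1) x * Real.log (u (i + 1) x)) * v j x ≥ 0 := by
    simp only [H.left_succ, H.right_succ]
    rw [← H.sum_succ_mul (fun x => u i x * Real.log (u i x)) (v j), ← Finset.sum_sub_distrib]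
    refine Finset.sum_nonneg fun x _ => ?_
    rw [← sub_mul]
    exact mul_nonneg (sub_nonneg.2 (H.mul_log_le (fun y => (H.left_pos i y).le) x))
      (H.right_pos j x).le
  have h3 : (∑ x, u (i + 1) x * v j x * (Real.log (v j x) - Real.log (u (i + 1) x))) -
      ∑ x, u i x * v (j + 1) x * (Real.log (v (j + 1) x) - Real.log (u i x)) =
      (∑ x, u (i + 1) x * (v j x * Real.log (v j x)) -
        ∑ x, u i x * (v (j + 1) x * Real.log (v (j + 1) x))) +
      (∑ x, (u i x * Real.log (u i x)) * v (j + 1) x -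
        ∑ x, (u (i + 1) x * Real.log (u (i + 1) x)) * v j x) := by
    simp only [← Finset.sum_sub_distrib, ← Finset.sum_add_distrib]
    exact Finset.sum_congr rfl fun x _ => by ring
  linarith

/-- The logarithm of the density is a function of vertex `i + 1` plus a function of vertex `i + 2`,
so the two one-time marginals suffice. -/
theorem HeatPair.entropy_insertionDensity (H : HeatPair S u v) {k : ℕ} {m : ℝ} (hm : 0 < m)
    (hm' : ∑ x, u 0 x * v k x = m) {i : ℕ} (hi : i < k) :
    ∑ w, pathWeight (k + 2) (fun _ => S) (u 0) (v 0) w *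
        (insertionDensity k u v m i w * Real.log (insertionDensity k u v m i w)) =
      -Real.log m + (messageEntropy k u v (i + 1) - messageEntropy k u v i) / m := by
  have hlog : ∀ w : Fin (k + 2 + 1) → V, Real.log (insertionDensity k u v m i w) =
      -Real.log m + (Real.log (v (k - (i + 1)) (w (Fin.ofNat _ (i + 1)))) -
        Real.log (u (i + 1) (w (Fin.ofNat _ (i + 1))))) -
      (Real.log (v (k - i) (w (Fin.ofNat _ (i + 2)))) -
        Real.log (u i (w (Fin.ofNat _ (i + 2))))) := by
    intro w
    have h1 := fun j x => (H.left_pos j x).ne'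
    have h2 := fun j x => (H.right_pos j x).ne'
    rw [insertionDensity, insertionRatio, Real.log_div (mul_ne_zero (h2 _ _) (h1 _ _))
      (mul_ne_zero (mul_ne_zero (h1 _ _) (h2 _ _)) hm.ne'), Real.log_mul (h2 _ _) (h1 _ _),
      Real.log_mul (mul_ne_zero (h1 _ _) (h2 _ _)) hm.ne', Real.log_mul (h1 _ _) (h2 _ _)]
    ring
  have e1 := H.sum_mul_insertionDensity_mul hm hi (Fin.ofNat _ (i + 1))
    fun x => -Real.log m + (Real.log (v (k - (i + 1)) x) - Real.log (u (i + 1) x))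
  have e2 := H.sum_mul_insertionDensity_mul hm hi (Fin.ofNat _ (i + 2))
    fun x => Real.log (v (k - i) x) - Real.log (u i x)
  simp only [Fin.ofNat, Nat.mod_eq_of_lt (show i + 1 < k + 2 + 1 by omega),
    Nat.mod_eq_of_lt (show i + 2 < k + 2 + 1 by omega), le_refl, if_true,
    show ¬ (i + 2 ≤ i + 1) by omega, if_false, show i + 2 - 2 = i by omega,
    show k + 2 - (i + 2) = k - i by omega] at e1 e2
  have e3 : ∑ x, u (i + 1) x * v (k - (i + 1)) x = m := by
    rw [H.sum_mul_eq, ← hm', show i + 1 + (k - (i + 1)) = k by omega]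
  have e4 : messageEntropy k u v (i + 1) / m - messageEntropy k u v i / m + -Real.log m =
      (∑ x, u (i + 1) x * v (k - (i + 1)) x / m *
        (-Real.log m + (Real.log (v (k - (i + 1)) x) - Real.log (u (i + 1) x)))) -
      ∑ x, u i x * v (k - i) x / m * (Real.log (v (k - i) x) - Real.log (u i x)) := by
    have e5 : -Real.log m = ∑ x, u (i + 1) x * v (k - (i + 1)) x / m * -Real.log m := by
      rw [← Finset.sum_mul, ← Finset.sum_div, e3, div_self hm.ne', one_mul]
    simp only [mul_add, Finset.sum_add_distrib]
    rw [← e5, messageEntropy, messageEntropy, Finset.sum_div, Finset.sum_div, add_sub_assoc,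
      add_comm, ← Finset.sum_sub_distrib, ← Finset.sum_sub_distrib]
    congr 1
    exact Finset.sum_congr rfl fun x _ => by ring
  rw [sub_div, add_comm (-Real.log m), e4, ← e1, ← e2, ← Finset.sum_sub_distrib]
  refine Finset.sum_congr rfl fun w _ => ?_
  rw [hlog]
  simp only [Fin.ofNat, Nat.mod_eq_of_lt (show i + 1 < k + 2 + 1 by omega),
    Nat.mod_eq_of_lt (show i + 2 < k + 2 + 1 by omega)]
  ring

theorem HeatPair.sum_insertionDensity_fiber [DecidableEq V] (H : HeatPair S u v) {k : ℕ} {m : ℝ}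
    (hm : 0 < m) {i : ℕ} (hi : i < k) (t : Fin (k + 2 + 1)) (x : V) :
    ∑ w with w t = x,
        pathWeight (k + 2) (fun _ => S) (u 0) (v 0) w * insertionDensity k u v m i w =
      (if (t : ℕ) ≤ i + 1 then u t x * v (k - t) x else u (t - 2) x * v (k + 2 - t) x) / m := by
  have := H.sum_mul_insertionDensity_mul hm hi t fun y => if y = x then 1 else 0
  simp only [mul_ite, mul_one, mul_zero, Finset.sum_ite_eq', Finset.mem_univ, if_true] at this
  rw [← this, Finset.sum_filter]

/-- Regroup the four messages as `u t * v (k + 2 - t)` and `u (t - 2) * v (k - t)`: each product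
sums to the mass of walks of length `k + 2` or `k - 2`. Then apply Cauchy–Schwarz. -/
theorem HeatPair.sum_sqrt_le (H : HeatPair S u v) {k : ℕ} {t : ℕ} (ht : 2 ≤ t) (htk : t ≤ k)
    {m : ℝ} (hm : 0 < m) :
    ∑ x, √(u (t - 2) x * v (k + 2 - t) x / m * (u t x * v (k - t) x / m)) ≤
      √((∑ x, u 0 x * v (k + 2) x) * ∑ x, u 0 x * v (k - 2) x) / m := by
  have hu := fun j x => (H.left_pos j x).le
  have hv := fun j x => (H.right_pos j x).le
  calc _ = (∑ x, √(u t x * v (k + 2 - t) x) * √(u (t - 2) x * v (k - t) x)) / m := by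
        rw [Finset.sum_div]
        refine Finset.sum_congr rfl fun x _ => ?_
        rw [← Real.sqrt_mul (mul_nonneg (hu _ _) (hv _ _)),
          show u (t - 2) x * v (k + 2 - t) x / m * (u t x * v (k - t) x / m) =
            u t x * v (k + 2 - t) x * (u (t - 2) x * v (k - t) x) / m ^ 2 by field_simp,
          Real.sqrt_div' _ (sq_nonneg m), Real.sqrt_sq hm.le]
    _ ≤ √(∑ x, u t x * v (k + 2 - t) x) * √(∑ x, u (t - 2) x * v (k - t) x) / m := by
        gcongr
        exact Real.sum_sqrt_mul_sqrt_le _ (fun x => mul_nonneg (hu _ _) (hv _ _))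
          fun x => mul_nonneg (hu _ _) (hv _ _)
    _ = _ := by
        rw [H.sum_mul_eq t, H.sum_mul_eq (t - 2), show t + (k + 2 - t) = k + 2 by omega,
          show t - 2 + (k - t) = k - 2 by omega, ← Real.sqrt_mul]
        exact Finset.sum_nonneg fun x _ => mul_nonneg (hu _ _) (hv _ _)

/-- If walks of length `k ± 2` from `u 0` to `v 0` are rare compared with walks of length `k`, then
the latter reveal a lot about their endpoints. -/
theorem HeatPair.le_messageEntropy_sub [Nonempty V] (H : HeatPair S u v) {k r : ℕ}
    (hr : 2 ^ r ≤ k) {ε : ℝ}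
    (hε : 2 ≤ k → √((∑ x, u 0 x * v (k + 2) x) * ∑ x, u 0 x * v (k - 2) x) ≤
      ε * ∑ x, u 0 x * v k x) :
    2 ^ r * (Real.log (∑ x, u 0 x * v k x) - Real.log (∑ x, u 0 x * v (k + 2) x) +
      r * (Real.log 2 - 2 * ε)) * ∑ x, u 0 x * v k x ≤
      messageEntropy k u v k - messageEntropy k u v 0 := by
  classical
  obtain ⟨m, hm'⟩ : ∃ m, ∑ x, u 0 x * v k x = m := ⟨_, rfl⟩
  have hm : 0 < m := hm' ▸ H.sum_mul_pos 0 k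
  rw [hm'] at hε ⊢
  have hk : 0 < 2 ^ r := by positivity
  set R := pathWeight (k + 2) (fun _ => S) (u 0) (v 0) with hRdef
  have hR : ∀ w, 0 ≤ R w := fun w => mul_nonneg (mul_nonneg (H.left_pos _ _).le
    (Finset.prod_nonneg fun t _ => H.nonneg _ _)) (H.right_pos _ _).le
  have hRsum : ∑ w, R w = ∑ x, u 0 x * v (k + 2) x := by
    have := sum_pathWeight (k + 2) (fun _ => S) (u 0) (fun t => v (k + 2 - t)) fun t ht x => by
      rw [← H.right_succ, show k + 2 - (t + 1) + 1 = k + 2 - t by omega]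
    simpa using this
  have hψ := fun i (w : Fin (k + 2 + 1) → V) => H.insertionDensity_pos hm (k := k) i w
  have hmass : ∀ i < k, ∑ w, R w * insertionDensity k u v m i w = 1 := by
    intro i hi
    have := H.sum_mul_insertionDensity_mul hm hi 0 fun _ => 1
    simp only [mul_one, Fin.val_zero, Nat.zero_le, if_true, Nat.sub_zero] at this
    rw [this, ← Finset.sum_div, hm', div_self hm.ne']
  -- At time `mid + 1` the walks with insertion `i < mid` are already delayed by two steps, while
  -- those with `i ≥ mid` are not.
  have hent := entropy_dyadicMean_le hR hψ hmass (ε := ε) (fun mid h0 hmid =>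
    ⟨fun w => w (Fin.ofNat _ (mid + 1)), _, _,
      fun i hi x => by
        rw [H.sum_insertionDensity_fiber hm (by omega), Fin.val_ofNat,
          Nat.mod_eq_of_lt (by omega), if_neg (by omega)],
      fun i hi hik x => by
        rw [H.sum_insertionDensity_fiber hm (by omega), Fin.val_ofNat,
          Nat.mod_eq_of_lt (by omega), if_pos (by omega)],
      (H.sum_sqrt_le (by omega) (by omega) hm).trans
        ((div_le_iff₀ hm).2 (hε (by omega)))⟩) r 0 (by omega)
  have hlow := neg_log_sum_le_entropy hR (dyadicMean_pos hψ 0 r)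
    (sum_mul_dyadicMean fun i _ hi => hmass i (by omega))
    (by rw [hRsum]; exact H.sum_mul_pos 0 _)
  rw [hRsum] at hlow
  have hsum : ∑ i ∈ Finset.range (2 ^ r), ∑ w, R w * (insertionDensity k u v m (0 + i) w *
      Real.log (insertionDensity k u v m (0 + i) w)) =
      2 ^ r * -Real.log m + (messageEntropy k u v (2 ^ r) - messageEntropy k u v 0) / m := by
    rw [← Finset.sum_range_sub, Finset.sum_div]
    rw [show (2 : ℝ) ^ r * -Real.log m = ∑ i ∈ Finset.range (2 ^ r), -Real.log m by simp,
      ← Finset.sum_add_distrib]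
    refine Finset.sum_congr rfl fun i hi => ?_
    rw [zero_add, H.entropy_insertionDensity hm hm' (by have := Finset.mem_range.1 hi; omega)]
  -- Only the first `2 ^ r` of the `k` insertions are mixed; the increments of the remaining steps
  -- are nonnegative.
  have hmono : messageEntropy k u v (2 ^ r) ≤ messageEntropy k u v k := by
    have : ∀ j, j ≤ k → 2 ^ r ≤ j → messageEntropy k u v (2 ^ r) ≤ messageEntropy k u v j := by
      intro j hj hrj
      induction j, hrj using Nat.le_induction with
      | base => exact le_rfl
      | succ j _ ih => exact (ih (by omega)).trans (H.messageEntropy_le_succ (by omega))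
    exact this k le_rfl hr
  rw [hsum] at hent
  have h1 := hlow.trans hent
  have h2 : (2 : ℝ) ^ r ≠ 0 := by positivity
  rw [add_div, mul_div_cancel_left₀ _ h2] at h1
  have h3 : (Real.log m - Real.log (∑ x, u 0 x * v (k + 2) x) + r * (Real.log 2 - 2 * ε)) ≤
      (messageEntropy k u v (2 ^ r) - messageEntropy k u v 0) / m / 2 ^ r := by linarith
  rw [div_div, le_div_iff₀ (by positivity)] at h3
  linarith

end Insertion

/-! ### Information of a leaf -/

section LeafInfo
open Matrix
variable {V : Type*} [Fintype V]

structure IsSymmStochastic (M : Matrix V V ℝ) : Prop where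
  nonneg : ∀ x y, 0 ≤ M x y
  symm : M.IsSymm
  sum_eq_one : ∀ x, ∑ y, M x y = 1

theorem IsSymmStochastic.pow [DecidableEq V] {M : Matrix V V ℝ} (h : IsSymmStochastic M) (k : ℕ) :
    IsSymmStochastic (M ^ k) := by
  refine ⟨?_, h.symm.pow k, ?_⟩
  · induction k with
    | zero =>
      intro x y
      rw [pow_zero, Matrix.one_apply]
      split_ifs <;> norm_num
    | succ k ih =>
      intro x y
      rw [pow_succ, Matrix.mul_apply]
      exact Finset.sum_nonneg fun z _ => mul_nonneg (ih x z) (h.nonneg z y)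
  · induction k with
    | zero => intro x; simp [Matrix.one_apply]
    | succ k ih =>
      intro x
      simp only [pow_succ, Matrix.mul_apply]
      rw [Finset.sum_comm]
      simp only [← Finset.mul_sum, h.sum_eq_one, mul_one, ih]

theorem IsSymmStochastic.mulVec_nonneg {M : Matrix V V ℝ} (h : IsSymmStochastic M) {f : V → ℝ}
    (hf : ∀ x, 0 ≤ f x) (x : V) : 0 ≤ (M *ᵥ f) x :=
  Finset.sum_nonneg fun y _ => mul_nonneg (h.nonneg x y) (hf y)

theorem IsSymmStochastic.mulVec_pos {M : Matrix V V ℝ} (h : IsSymmStochastic M) {f : V → ℝ}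
    (hf : ∀ x, 0 < f x) (x : V) : 0 < (M *ᵥ f) x := by
  obtain ⟨y, -, hy⟩ := Finset.exists_lt_of_sum_lt (s := Finset.univ) (f := fun _ : V => (0 : ℝ))
    (g := fun y => M x y) (by simp [h.sum_eq_one])
  exact Finset.sum_pos' (fun y _ => mul_nonneg (h.nonneg x y) (hf y).le)
    ⟨y, Finset.mem_univ y, mul_pos hy (hf y)⟩

theorem IsSymmStochastic.dotProduct_mulVec_comm {M : Matrix V V ℝ} (h : IsSymmStochastic M)
    (f g : V → ℝ) : f ⬝ᵥ M *ᵥ g = g ⬝ᵥ M *ᵥ f := by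
  rw [Matrix.dotProduct_mulVec, ← Matrix.mulVec_transpose, h.symm, dotProduct_comm]

/-- For weights `f`, `g` of a rectangle, the (unnormalized) information about the second input
that is revealed to the holder of the first. -/
noncomputable def sideInfo (M : Matrix V V ℝ) (f g : V → ℝ) : ℝ :=
  ∑ x, f x * ((M *ᵥ fun y => g y * Real.log (g y)) x - (M *ᵥ g) x * Real.log ((M *ᵥ g) x))

variable {M : Matrix V V ℝ} {f g : V → ℝ}

theorem sideInfo_nonneg (h : IsSymmStochastic M) (hf : ∀ x, 0 ≤ f x) (hg : ∀ x, 0 ≤ g x) :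
    0 ≤ sideInfo M f g := by
  refine Finset.sum_nonneg fun x _ => mul_nonneg (hf x) (sub_nonneg.2 ?_)
  have := Real.convexOn_mul_log.map_sum_le (t := Finset.univ) (w := fun y => M x y) (p := g)
    (fun y _ => h.nonneg x y) (h.sum_eq_one x) fun y _ => hg y
  simpa [smul_eq_mul, Matrix.mulVec, dotProduct] using this

/-- Since `M x y * g y ≤ (M *ᵥ g) x`, the log-ratio of `g y` to `(M *ᵥ g) x` is at most `-log (M x
y)`. The crude constant is harmless: the bound only has to be uniform over protocol trees. -/
theorem sideInfo_le (h : IsSymmStochastic M) (hf : ∀ x, 0 ≤ f x) (hg : ∀ x, 0 ≤ g x) :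
    sideInfo M f g ≤ (∑ x, ∑ y, |Real.log (M x y)|) * (f ⬝ᵥ M *ᵥ g) := by
  set C := ∑ x, ∑ y, |Real.log (M x y)| with hC
  have hCle : ∀ x y, |Real.log (M x y)| ≤ C := fun x y =>
    (Finset.single_le_sum (f := fun y => |Real.log (M x y)|) (fun y _ => abs_nonneg _)
      (Finset.mem_univ y)).trans
    (Finset.single_le_sum (f := fun x => ∑ y, |Real.log (M x y)|)
      (fun x _ => Finset.sum_nonneg fun y _ => abs_nonneg _) (Finset.mem_univ x))
  rw [sideInfo, dotProduct, Finset.mul_sum]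
  refine Finset.sum_le_sum fun x _ => ?_
  rw [mul_left_comm]
  refine mul_le_mul_of_nonneg_left ?_ (hf x)
  have key : ∀ y, M x y * (g y * Real.log (g y)) ≤
      M x y * g y * (C + Real.log ((M *ᵥ g) x)) := by
    intro y
    rcases (h.nonneg x y).eq_or_lt with h0 | h0
    · simp [← h0]
    rcases (hg y).eq_or_lt with h1 | h1
    · simp [← h1]
    rw [← mul_assoc]
    refine mul_le_mul_of_nonneg_left ?_ (mul_pos h0 h1).le
    have h2 : M x y * g y ≤ (M *ᵥ g) x :=
      Finset.single_le_sum (f := fun y => M x y * g y)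
        (fun y _ => mul_nonneg (h.nonneg x y) (hg y)) (Finset.mem_univ y)
    have h3 := Real.log_le_log (mul_pos h0 h1) h2
    rw [Real.log_mul h0.ne' h1.ne'] at h3
    have := neg_abs_le (Real.log (M x y))
    have := hCle x y
    linarith
  have h4 := Finset.sum_le_sum fun y (_ : y ∈ Finset.univ) => key y
  rw [← Finset.sum_mul] at h4
  change (M *ᵥ fun y => g y * Real.log (g y)) x ≤ (M *ᵥ g) x * _ at h4
  linarith

theorem sideInfo_add_left (f f' g : V → ℝ) :
    sideInfo M (f + f') g = sideInfo M f g + sideInfo M f' g := by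
  simp [sideInfo, add_mul, Finset.sum_add_distrib]

/-- One extra bit reveals at most one bit. Inside the average, `φ, ψ ≤ 1` lets their logarithms be
dropped (`hη`); outside, convexity of `t log t` loses at most `log 2` times the mass (`hmid`). -/
theorem sideInfo_add_le (h : IsSymmStochastic M) {φ ψ : V → ℝ} (hf : ∀ x, 0 ≤ f x)
    (hg : ∀ x, 0 ≤ g x) (hφ : ∀ x, 0 ≤ φ x) (hψ : ∀ x, 0 ≤ ψ x) (hs : ∀ x, φ x + ψ x = 1) :
    sideInfo M g (fun x => f x * φ x) + sideInfo M g (fun x => f x * ψ x) ≤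
      sideInfo M g f + Real.log 2 * (g ⬝ᵥ M *ᵥ f) := by
  have hη : ∀ a t : ℝ, 0 ≤ t → t ≤ 1 → 0 ≤ a →
      a * t * Real.log (a * t) ≤ a * t * Real.log a := by
    intro a t ht ht' ha
    rcases ht.eq_or_lt with h1 | h1
    · simp [← h1]
    rcases ha.eq_or_lt with h2 | h2
    · simp [← h2]
    refine mul_le_mul_of_nonneg_left (Real.log_le_log (by positivity) ?_) (by positivity)
    nlinarith
  have hmid : ∀ a b : ℝ, 0 ≤ a → 0 ≤ b → (a + b) * Real.log (a + b) - Real.log 2 * (a + b) ≤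
      a * Real.log a + b * Real.log b := by
    intro a b ha hb
    rcases (add_nonneg ha hb).eq_or_lt with h0 | h0
    · have ha' : a = 0 := by linarith
      have hb' : b = 0 := by linarith
      simp [ha', hb']
    have := Real.convexOn_mul_log.2 ha hb (by norm_num : (0 : ℝ) ≤ 1 / 2)
      (by norm_num : (0 : ℝ) ≤ 1 / 2) (by norm_num)
    simp only [smul_eq_mul] at this
    rw [show 1 / 2 * a + 1 / 2 * b = (a + b) / 2 by ring, Real.log_div h0.ne' two_ne_zero] at this
    linarith
  rw [sideInfo, sideInfo, sideInfo, dotProduct, Finset.mul_sum, ← Finset.sum_add_distrib,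
    ← Finset.sum_add_distrib]
  refine Finset.sum_le_sum fun x _ => ?_
  rw [← mul_add, mul_left_comm, ← mul_add]
  refine mul_le_mul_of_nonneg_left ?_ (hg x)
  have e1 : (M *ᵥ fun x => f x * φ x) x + (M *ᵥ fun x => f x * ψ x) x = (M *ᵥ f) x := by
    simp only [Matrix.mulVec, dotProduct, ← Finset.sum_add_distrib]
    exact Finset.sum_congr rfl fun y _ => by rw [← mul_add, ← mul_add, hs, mul_one]
  have e2 := hmid ((M *ᵥ fun x => f x * φ x) x) ((M *ᵥ fun x => f x * ψ x) x)
    (h.mulVec_nonneg (fun y => mul_nonneg (hf y) (hφ y)) x)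
    (h.mulVec_nonneg (fun y => mul_nonneg (hf y) (hψ y)) x)
  have e3 : (M *ᵥ fun y => f y * φ y * Real.log (f y * φ y)) x +
      (M *ᵥ fun y => f y * ψ y * Real.log (f y * ψ y)) x ≤
      (M *ᵥ fun y => f y * Real.log (f y)) x := by
    simp only [Matrix.mulVec, dotProduct, ← Finset.sum_add_distrib]
    refine Finset.sum_le_sum fun y _ => ?_
    rw [← mul_add]
    refine mul_le_mul_of_nonneg_left ?_ (h.nonneg x y)
    have h1 := hη (f y) (φ y) (hφ y) (by linarith [hs y, hψ y]) (hf y)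
    have h2 := hη (f y) (ψ y) (hψ y) (by linarith [hs y, hφ y]) (hf y)
    calc _ ≤ f y * φ y * Real.log (f y) + f y * ψ y * Real.log (f y) := add_le_add h1 h2
      _ = f y * (φ y + ψ y) * Real.log (f y) := by ring
      _ = _ := by rw [hs, mul_one]
  rw [e1] at e2
  linarith

theorem continuous_sideInfo_add (M : Matrix V V ℝ) (f g : V → ℝ) :
    Continuous fun e : ℝ => sideInfo M (fun x => f x + e) fun x => g x + e := by
  have h : Continuous fun t : ℝ => t * Real.log t := Real.continuous_mul_log
  simp only [sideInfo, Matrix.mulVec, dotProduct]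
  refine continuous_finsetSum _ fun x _ => Continuous.mul (by fun_prop) (Continuous.sub ?_ ?_)
  · exact continuous_finsetSum _ fun y _ => continuous_const.mul (h.comp (by fun_prop))
  · exact h.comp (by fun_prop)

theorem IsSymmStochastic.heatPair [DecidableEq V] {S : Matrix V V ℝ} (h : IsSymmStochastic S)
    (hf : ∀ x, 0 < f x) (hg : ∀ x, 0 < g x) :
    HeatPair S (fun j => S ^ j *ᵥ f) fun j => S ^ j *ᵥ g where
  nonneg := h.nonneg
  symm x y := h.symm.apply y x
  sum_eq_one := h.sum_eq_one
  left_pos j := (h.pow j).mulVec_pos hf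
  right_pos j := (h.pow j).mulVec_pos hg
  left_succ j x := by rw [pow_succ', ← Matrix.mulVec_mulVec]; rfl
  right_succ j x := by rw [pow_succ', ← Matrix.mulVec_mulVec]; rfl

/-- Symmetry of `S ^ k` moves it from `f` to `g log g` and from `g` to `f log f`; the four terms
then pair up into the two side informations. -/
theorem IsSymmStochastic.messageEntropy_sub [DecidableEq V] {S : Matrix V V ℝ}
    (h : IsSymmStochastic S) (k : ℕ) :
    messageEntropy k (fun j => S ^ j *ᵥ f) (fun j => S ^ j *ᵥ g) k -
      messageEntropy k (fun j => S ^ j *ᵥ f) (fun j => S ^ j *ᵥ g) 0 =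
      sideInfo (S ^ k) f g + sideInfo (S ^ k) g f := by
  have e1 := (h.pow k).dotProduct_mulVec_comm f fun y => g y * Real.log (g y)
  have e2 := (h.pow k).dotProduct_mulVec_comm g fun y => f y * Real.log (f y)
  simp only [sideInfo, messageEntropy, Nat.sub_self, pow_zero, Matrix.one_mulVec, Nat.sub_zero,
    mul_sub, Finset.sum_sub_distrib]
  simp only [dotProduct] at e1 e2
  rw [e1, e2]
  simp only [← Finset.sum_sub_distrib, ← Finset.sum_add_distrib]
  exact Finset.sum_congr rfl fun x _ => by ring

/-- The lower walk matrix `S ^ (k - 2)`, or zero if there is no such power. -/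
noncomputable def lowerPow [DecidableEq V] (S : Matrix V V ℝ) (k : ℕ) : Matrix V V ℝ :=
  if 2 ≤ k then S ^ (k - 2) else 0

theorem IsSymmStochastic.lowerPow_nonneg [DecidableEq V] {S : Matrix V V ℝ}
    (h : IsSymmStochastic S) (k : ℕ) (x y : V) : 0 ≤ lowerPow S k x y := by
  rw [lowerPow]
  split_ifs
  · exact (h.pow _).nonneg x y
  · exact le_rfl

/-- With `r = Nat.log 2 k`, `2 ^ r ≥ k / 2` and `log k ≤ r + 1`. The bracket is at least `log (1 /
δ) - log 100 + r / 2`, and `δ ≤ 100⁻³` makes this at least half of `log (k / δ)`. -/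
theorem two_pow_log_bound {k : ℕ} (hk : 1 ≤ k) {δ : ℝ} (hδ : 0 < δ) (hδ' : δ ≤ 1 / 10 ^ 6)
    {m m₂ : ℝ} (hm : 0 < m) (hm₂ : 0 < m₂) (h : m₂ ≤ 100 * δ * m) :
    k / 4 * Real.log (k / δ) ≤ 2 ^ Nat.log 2 k *
      (Real.log m - Real.log m₂ + Nat.log 2 k * (Real.log 2 - 2 * (100 * δ))) := by
  set r := Nat.log 2 k
  have hk0 : (0 : ℝ) < k := by exact_mod_cast hk
  have h1 : (k : ℝ) / 2 ≤ 2 ^ r := by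
    have := Nat.lt_pow_succ_log_self (b := 2) (by norm_num) k
    have h' : (k : ℝ) < 2 ^ (r + 1) := by exact_mod_cast this
    rw [pow_succ] at h'
    linarith
  have hl2 := Real.log_two_gt_d9
  have hl2' := Real.log_two_lt_d9
  have h2 : Real.log k ≤ r + 1 := by
    have h3 : Real.log k ≤ Real.log (2 ^ (r + 1)) :=
      Real.log_le_log hk0 (by rw [pow_succ]; linarith)
    rw [Real.log_pow] at h3
    push_cast at h3
    nlinarith [(Nat.cast_nonneg r : (0 : ℝ) ≤ r)]
  have h4 : Real.log m₂ ≤ Real.log 100 + Real.log δ + Real.log m := by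
    rw [← Real.log_mul (by norm_num) hδ.ne', ← Real.log_mul (by positivity) hm.ne']
    exact Real.log_le_log hm₂ h
  have h5 : Real.log δ ≤ -(3 * Real.log 100) := by
    rw [show -(3 * Real.log 100) = Real.log (1 / 10 ^ 6) by
      rw [one_div, Real.log_inv, show (10 : ℝ) ^ 6 = 100 ^ 3 by norm_num, Real.log_pow]
      norm_num]
    exact Real.log_le_log hδ hδ'
  have h6 : 1 ≤ Real.log 100 := by
    rw [Real.le_log_iff_exp_le (by norm_num)]
    linarith [Real.exp_one_lt_d9]
  have h0 : 0 ≤ Real.log k := Real.log_nonneg (by exact_mod_cast hk)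
  have h7 : (r : ℝ) * (1 / 2) ≤ r * (Real.log 2 - 2 * (100 * δ)) := by
    refine mul_le_mul_of_nonneg_left ?_ (Nat.cast_nonneg r)
    linarith
  rw [Real.log_div hk0.ne' hδ.ne']
  have h8 : (Real.log k - Real.log δ) / 2 ≤
      Real.log m - Real.log m₂ + r * (Real.log 2 - 2 * (100 * δ)) := by linarith
  calc (k : ℝ) / 4 * (Real.log k - Real.log δ) = k / 2 * ((Real.log k - Real.log δ) / 2) := by ring
    _ ≤ 2 ^ r * ((Real.log k - Real.log δ) / 2) := by
        refine mul_le_mul_of_nonneg_right h1 ?_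
        linarith
    _ ≤ _ := mul_le_mul_of_nonneg_left h8 (by positivity)

theorem IsSymmStochastic.leaf_bound_of_pos [DecidableEq V] [Nonempty V] {S : Matrix V V ℝ}
    (h : IsSymmStochastic S) {k : ℕ} (hk : 1 ≤ k) {δ : ℝ} (hδ : 0 < δ) (hδ' : δ ≤ 1 / 10 ^ 6)
    (hf : ∀ x, 0 < f x) (hg : ∀ x, 0 < g x) :
    k / 4 * Real.log (k / δ) * (f ⬝ᵥ S ^ k *ᵥ g -
      (f ⬝ᵥ S ^ (k + 2) *ᵥ g + f ⬝ᵥ lowerPow S k *ᵥ g) / (100 * δ)) ≤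
      sideInfo (S ^ k) f g + sideInfo (S ^ k) g f := by
  have H := h.heatPair hf hg
  have hf' := fun x => (hf x).le
  have hg' := fun x => (hg x).le
  have hk0 : (1 : ℝ) ≤ k := by exact_mod_cast hk
  have hL : 0 ≤ k / 4 * Real.log (k / δ) := by
    refine mul_nonneg (by positivity) (Real.log_nonneg ?_)
    rw [le_div_iff₀ hδ]
    linarith
  have hlow : 0 ≤ f ⬝ᵥ lowerPow S k *ᵥ g := Finset.sum_nonneg fun x _ => mul_nonneg (hf' x)
    (Finset.sum_nonneg fun y _ => mul_nonneg (h.lowerPow_nonneg k x y) (hg' y))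
  have hpos : ∀ j, 0 < f ⬝ᵥ S ^ j *ᵥ g := fun j => Finset.sum_pos
    (fun x _ => mul_pos (hf x) ((h.pow j).mulVec_pos hg x)) Finset.univ_nonempty
  by_cases hc : f ⬝ᵥ S ^ (k + 2) *ᵥ g ≤ 100 * δ * (f ⬝ᵥ S ^ k *ᵥ g) ∧
      f ⬝ᵥ lowerPow S k *ᵥ g ≤ 100 * δ * (f ⬝ᵥ S ^ k *ᵥ g)
  -- On a leaf with few errors the entropy bound applies. On any other leaf the left side is
  -- nonpositive and nonnegativity of information is enough.
  · have key := H.le_messageEntropy_sub (k := k) (r := Nat.log 2 k)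
      (Nat.pow_log_le_self 2 (by omega)) (ε := 100 * δ) fun hk2 => by
        have e : lowerPow S k = S ^ (k - 2) := if_pos hk2
        rw [e] at hc
        simp only [pow_zero, Matrix.one_mulVec]
        refine Real.sqrt_le_iff.2 ⟨mul_nonneg (by positivity) (hpos k).le, ?_⟩
        rw [sq]
        exact mul_le_mul hc.1 hc.2 (hpos (k - 2)).le (mul_nonneg (by positivity) (hpos k).le)
    rw [h.messageEntropy_sub] at key
    simp only [pow_zero, Matrix.one_mulVec] at key
    refine le_trans ?_ key
    have hb := two_pow_log_bound hk hδ hδ' (hpos k) (hpos (k + 2)) hc.1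
    refine le_trans ?_ (mul_le_mul_of_nonneg_right hb (hpos k).le)
    refine mul_le_mul_of_nonneg_left ?_ hL
    have : 0 ≤ (f ⬝ᵥ S ^ (k + 2) *ᵥ g + f ⬝ᵥ lowerPow S k *ᵥ g) / (100 * δ) :=
      div_nonneg (add_nonneg (hpos _).le hlow) (by positivity)
    exact sub_le_self _ this
  · refine le_trans ?_ (add_nonneg (sideInfo_nonneg (h.pow k) hf' hg')
      (sideInfo_nonneg (h.pow k) hg' hf'))
    refine mul_nonpos_of_nonneg_of_nonpos hL (sub_nonpos.2 ?_)
    rw [le_div_iff₀ (by positivity), mul_comm]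
    rw [not_and_or, not_le, not_le] at hc
    rcases hc with hc | hc
    · linarith
    · linarith [(hpos (k + 2)).le]

/-- Weights of a leaf may vanish. Shift them by `e > 0` and let `e → 0`, using continuity of `t log
t` at zero. -/
theorem IsSymmStochastic.leaf_bound [DecidableEq V] [Nonempty V] {S : Matrix V V ℝ}
    (h : IsSymmStochastic S) {k : ℕ} (hk : 1 ≤ k) {δ : ℝ} (hδ : 0 < δ) (hδ' : δ ≤ 1 / 10 ^ 6)
    (hf : ∀ x, 0 ≤ f x) (hg : ∀ x, 0 ≤ g x) :
    k / 4 * Real.log (k / δ) * (f ⬝ᵥ S ^ k *ᵥ g -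
      (f ⬝ᵥ S ^ (k + 2) *ᵥ g + f ⬝ᵥ lowerPow S k *ᵥ g) / (100 * δ)) ≤
      sideInfo (S ^ k) f g + sideInfo (S ^ k) g f := by
  have hcont : ∀ A : Matrix V V ℝ,
      Continuous fun e : ℝ => (fun x => f x + e) ⬝ᵥ A *ᵥ fun x => g x + e := by
    intro A
    simp only [Matrix.mulVec, dotProduct]
    fun_prop
  have hl : Continuous fun e : ℝ => k / 4 * Real.log (k / δ) *
      ((fun x => f x + e) ⬝ᵥ S ^ k *ᵥ (fun x => g x + e) -
        ((fun x => f x + e) ⬝ᵥ S ^ (k + 2) *ᵥ (fun x => g x + e) +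
          (fun x => f x + e) ⬝ᵥ lowerPow S k *ᵥ (fun x => g x + e)) / (100 * δ)) :=
    continuous_const.mul ((hcont _).sub (((hcont _).add (hcont _)).div_const _))
  have hr := (continuous_sideInfo_add (S ^ k) f g).add (continuous_sideInfo_add (S ^ k) g f)
  have := le_of_tendsto_of_tendsto (b := nhdsWithin (0 : ℝ) (Set.Ioi 0))
    (hl.continuousAt.tendsto.mono_left nhdsWithin_le_nhds)
    (hr.continuousAt.tendsto.mono_left nhdsWithin_le_nhds) (by
      filter_upwards [self_mem_nhdsWithin] with e he
      exact h.leaf_bound_of_pos hk hδ hδ' (fun x => add_pos_of_nonneg_of_pos (hf x) he)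
        fun x => add_pos_of_nonneg_of_pos (hg x) he)
  simp only [Pi.add_apply, add_zero] at this
  exact this

end LeafInfo

/-! ### Probability mass functions -/

section PMFs
variable {α β γ : Type*}

theorem toReal_map_apply [DecidableEq β] (P : PMF α) (f : α → β) (F : Finset α)
    (hF : ∀ t ∉ F, P t = 0) (z : β) :
    (P.map f z).toReal = ∑ t ∈ F, if z = f t then (P t).toReal else 0 := by
  rw [PMF.map_apply, tsum_eq_sum (s := F) fun t ht => by simp [hF t ht],
    ENNReal.toReal_sum fun t _ => by split_ifs <;> simp [P.apply_ne_top]]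
  refine Finset.sum_congr rfl fun t _ => ?_
  by_cases h : z = f t <;> simp [h]

theorem map_apply_of_injective (P : PMF α) {f : α → β} (hf : Function.Injective f) (t : α) :
    P.map f (f t) = P t := by
  classical
  rw [PMF.map_apply, tsum_eq_single t fun s hs => if_neg fun h => hs (hf h.symm), if_pos rfl]

theorem map_apply_eq_zero (P : PMF α) {f : α → β} {z : β} (h : ∀ t, f t ≠ z) : P.map f z = 0 := by
  classical
  rw [PMF.map_apply]
  simp [fun t => (h t).symm]

theorem toReal_bool_add (p : PMF Bool) : (p true).toReal + (p false).toReal = 1 := by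
  have h := p.tsum_coe
  rw [tsum_fintype, Fintype.sum_bool] at h
  rw [← ENNReal.toReal_add (p.apply_ne_top _) (p.apply_ne_top _), h, ENNReal.toReal_one]

theorem map_fst_apply (P : PMF (α × Bool)) (s : α) :
    P.map Prod.fst s = P (s, true) + P (s, false) := by
  classical
  rw [PMF.map_apply, ENNReal.tsum_prod', tsum_eq_single s fun t ht => by simp [ht.symm]]
  simp [tsum_fintype]

end PMFs

/-! ### Factorization of protocols -/

/-- The rectangle property: the probability of a transcript and an output is a product of a
function of Alice's and a function of Bob's input, and only one player determines the output. -/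
structure Factorization {X Y : Type} (T : ProtocolTree X Y) where
  leaves : Finset (List Bool)
  alice : List Bool → X → ℝ
  bob : List Bool → Y → ℝ
  aliceOut : List Bool → Bool → X → ℝ
  bobOut : List Bool → Bool → Y → ℝ
  alice_nonneg : ∀ s x, 0 ≤ alice s x
  bob_nonneg : ∀ s y, 0 ≤ bob s y
  aliceOut_nonneg : ∀ s o x, 0 ≤ aliceOut s o x
  bobOut_nonneg : ∀ s o y, 0 ≤ bobOut s o y
  alice_eq_zero : ∀ s ∉ leaves, ∀ x, alice s x = 0
  out : ∀ s, ((∀ x, aliceOut s true x + aliceOut s false x = 1) ∧ ∀ o y, bobOut s o y = 1) ∨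
    ((∀ y, bobOut s true y + bobOut s false y = 1) ∧ ∀ o x, aliceOut s o x = 1)
  run_eq : ∀ x y s o, (T.run x y (s, o)).toReal =
    alice s x * bob s y * (aliceOut s o x * bobOut s o y)

section Factor
variable {X Y : Type}

theorem map_cons_apply_nil (P : PMF (List Bool × Bool)) (b o : Bool) :
    (P.map fun t => (b :: t.1, t.2)) ([], o) = 0 :=
  map_apply_eq_zero P fun t h => by simp at h

theorem map_cons_apply_cons (P : PMF (List Bool × Bool)) (b c : Bool) (l : List Bool) (o : Bool) :
    (P.map fun t => (b :: t.1, t.2)) (c :: l, o) = if b = c then P (l, o) else 0 := by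
  split_ifs with h
  · subst h
    exact map_apply_of_injective P (f := fun t : List Bool × Bool => (b :: t.1, t.2))
      (fun s t h => by simpa [Prod.ext_iff] using h) (l, o)
  · exact map_apply_eq_zero P fun t h' => by
      simp only [Prod.mk.injEq, List.cons.injEq] at h'
      exact h h'.1.1

theorem toReal_bind_cons (p : PMF Bool) (P : Bool → PMF (List Bool × Bool)) (s : List Bool)
    (o : Bool) :
    ((p.bind fun b => (P b).map fun t => (b :: t.1, t.2)) (s, o)).toReal =
      match s with
      | [] => 0
      | c :: l => (p c).toReal * (P c (l, o)).toReal := by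
  rw [PMF.bind_apply, tsum_fintype, Fintype.sum_bool]
  cases s with
  | nil => simp only [map_cons_apply_nil, mul_zero, add_zero, ENNReal.toReal_zero]
  | cons c l => cases c <;> simp only [map_cons_apply_cons] <;> simp

theorem toReal_map_nil (p : PMF Bool) (s : List Bool) (o : Bool) :
    ((p.map fun o => (([] : List Bool), o)) (s, o)).toReal =
      if s = [] then (p o).toReal else 0 := by
  split_ifs with h
  · subst h
    rw [map_apply_of_injective p (f := fun o => (([] : List Bool), o)) fun _ _ h => by simpa using h]
  · rw [map_apply_eq_zero p fun t h' => h (by simp only [Prod.mk.injEq] at h'; exact h'.1.symm)]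
    simp

/-- The leaves of a tree, from those of the two subtrees. -/
def consLeaves (F : Bool → Finset (List Bool)) : Finset (List Bool) :=
  Finset.univ.biUnion fun b => (F b).image (List.cons b)

theorem mem_consLeaves {F : Bool → Finset (List Bool)} {c : Bool} {l : List Bool} (h : l ∈ F c) :
    c :: l ∈ consLeaves F :=
  Finset.mem_biUnion.2 ⟨c, Finset.mem_univ c, Finset.mem_image_of_mem _ h⟩

theorem nonempty_factorization (T : ProtocolTree X Y) : Nonempty (Factorization T) := by
  induction T with
  | aliceOutputs f =>
    exact ⟨{
      leaves := {[]}
      alice := fun s _ => if s = [] then 1 else 0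
      bob := fun _ _ => 1
      aliceOut := fun _ o x => (biasedCoin (f x) o).toReal
      bobOut := fun _ _ _ => 1
      alice_nonneg := fun s x => by positivity
      bob_nonneg := fun _ _ => zero_le_one
      aliceOut_nonneg := fun _ _ _ => ENNReal.toReal_nonneg
      bobOut_nonneg := fun _ _ _ => zero_le_one
      alice_eq_zero := fun s hs x => if_neg (by simpa using hs)
      out := fun s => Or.inl ⟨fun x => toReal_bool_add _, fun _ _ => rfl⟩
      run_eq := fun x y s o => by
        rw [ProtocolTree.run, toReal_map_nil]
        split_ifs <;> simp }⟩
  | bobOutputs g =>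
    exact ⟨{
      leaves := {[]}
      alice := fun s _ => if s = [] then 1 else 0
      bob := fun _ _ => 1
      aliceOut := fun _ _ _ => 1
      bobOut := fun _ o y => (biasedCoin (g y) o).toReal
      alice_nonneg := fun s x => by positivity
      bob_nonneg := fun _ _ => zero_le_one
      aliceOut_nonneg := fun _ _ _ => zero_le_one
      bobOut_nonneg := fun _ _ _ => ENNReal.toReal_nonneg
      alice_eq_zero := fun s hs x => if_neg (by simpa using hs)
      out := fun s => Or.inr ⟨fun x => toReal_bool_add _, fun _ _ => rfl⟩
      run_eq := fun x y s o => by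
        rw [ProtocolTree.run, toReal_map_nil]
        split_ifs <;> simp }⟩
  | aliceSends p next ih =>
    have F := fun b => (ih b).some
    exact ⟨{
      leaves := consLeaves fun b => (F b).leaves
      alice := fun s x => match s with
        | [] => 0
        | c :: l => (biasedCoin (p x) c).toReal * (F c).alice l x
      bob := fun s y => match s with
        | [] => 0
        | c :: l => (F c).bob l y
      -- The empty transcript has weight zero at an inner node, so the output factors there only
      -- need to satisfy `out` and nonnegativity; those of a subtree serve.
      aliceOut := fun s => match s with
        | [] => (F true).aliceOut []
        | c :: l => (F c).aliceOut l
      bobOut := fun s => match s with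
        | [] => (F true).bobOut []
        | c :: l => (F c).bobOut l
      alice_nonneg := fun s x => by
        cases s with
        | nil => exact le_rfl
        | cons c l => exact mul_nonneg ENNReal.toReal_nonneg ((F c).alice_nonneg l x)
      bob_nonneg := fun s y => by
        cases s with
        | nil => exact le_rfl
        | cons c l => exact (F c).bob_nonneg l y
      aliceOut_nonneg := fun s => by
        cases s with
        | nil => exact (F true).aliceOut_nonneg []
        | cons c l => exact (F c).aliceOut_nonneg l
      bobOut_nonneg := fun s => by
        cases s with
        | nil => exact (F true).bobOut_nonneg []
        | cons c l => exact (F c).bobOut_nonneg l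
      alice_eq_zero := fun s hs x => by
        cases s with
        | nil => rfl
        | cons c l =>
          exact mul_eq_zero_of_right _ ((F c).alice_eq_zero l (fun h => hs (mem_consLeaves h)) x)
      out := fun s => by
        cases s with
        | nil => exact (F true).out []
        | cons c l => exact (F c).out l
      run_eq := fun x y s o => by
        rw [ProtocolTree.run, toReal_bind_cons]
        cases s with
        | nil => simp
        | cons c l =>
          simp only [(F c).run_eq]
          ring }⟩
  | bobSends q next ih =>
    have F := fun b => (ih b).some
    exact ⟨{
      leaves := consLeaves fun b => (F b).leaves
      alice := fun s x => match s with
        | [] => 0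
        | c :: l => (F c).alice l x
      bob := fun s y => match s with
        | [] => 0
        | c :: l => (biasedCoin (q y) c).toReal * (F c).bob l y
      aliceOut := fun s => match s with
        | [] => (F true).aliceOut []
        | c :: l => (F c).aliceOut l
      bobOut := fun s => match s with
        | [] => (F true).bobOut []
        | c :: l => (F c).bobOut l
      alice_nonneg := fun s x => by
        cases s with
        | nil => exact le_rfl
        | cons c l => exact (F c).alice_nonneg l x
      bob_nonneg := fun s y => by
        cases s with
        | nil => exact le_rfl
        | cons c l => exact mul_nonneg ENNReal.toReal_nonneg ((F c).bob_nonneg l y)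
      aliceOut_nonneg := fun s => by
        cases s with
        | nil => exact (F true).aliceOut_nonneg []
        | cons c l => exact (F c).aliceOut_nonneg l
      bobOut_nonneg := fun s => by
        cases s with
        | nil => exact (F true).bobOut_nonneg []
        | cons c l => exact (F c).bobOut_nonneg l
      alice_eq_zero := fun s hs x => by
        cases s with
        | nil => rfl
        | cons c l => exact (F c).alice_eq_zero l (fun h => hs (mem_consLeaves h)) x
      out := fun s => by
        cases s with
        | nil => exact (F true).out []
        | cons c l => exact (F c).out l
      run_eq := fun x y s o => by
        rw [ProtocolTree.run, toReal_bind_cons]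
        cases s with
        | nil => simp
        | cons c l =>
          simp only [(F c).run_eq]
          ring }⟩

variable {T : ProtocolTree X Y}

theorem Factorization.transcript_eq (F : Factorization T) (x : X) (y : Y) (s : List Bool) :
    (((T.run x y).map Prod.fst) s).toReal = F.alice s x * F.bob s y := by
  rw [map_fst_apply, ENNReal.toReal_add (PMF.apply_ne_top _ _) (PMF.apply_ne_top _ _), F.run_eq,
    F.run_eq]
  rcases F.out s with ⟨h1, h2⟩ | ⟨h1, h2⟩
  · rw [h2, h2, mul_one, mul_one, ← mul_add, h1, mul_one]
  · rw [h2, h2, one_mul, one_mul, ← mul_add, h1, mul_one]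

theorem Factorization.transcript_eq_zero (F : Factorization T) (x : X) (y : Y) {s : List Bool} (hs : s ∉ F.leaves) :
    ((T.run x y).map Prod.fst) s = 0 := by
  have := F.transcript_eq x y s
  rw [F.alice_eq_zero s hs, zero_mul, ENNReal.toReal_eq_zero_iff] at this
  exact this.resolve_right (PMF.apply_ne_top _ _)

theorem Factorization.sum_eq_one (F : Factorization T) (x : X) (y : Y) :
    ∑ s ∈ F.leaves, F.alice s x * F.bob s y = 1 := by
  simp only [← F.transcript_eq]
  have h := ((T.run x y).map Prod.fst).tsum_coe
  rw [tsum_eq_sum fun s hs => F.transcript_eq_zero x y hs] at h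
  rw [← ENNReal.toReal_sum fun s _ => PMF.apply_ne_top _ _, h, ENNReal.toReal_one]

theorem Factorization.output_eq (F : Factorization T) (x : X) (y : Y) (o : Bool) :
    (((T.run x y).map Prod.snd) o).toReal =
      ∑ s ∈ F.leaves, (F.alice s x * F.aliceOut s o x) * (F.bob s y * F.bobOut s o y) := by
  rw [toReal_map_apply _ _ (F.leaves ×ˢ Finset.univ), Finset.sum_product]
  · refine Finset.sum_congr rfl fun s _ => ?_
    rw [Finset.sum_ite_eq, if_pos (Finset.mem_univ o), F.run_eq]
    ring
  · rintro ⟨s, o⟩ h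
    have hs : s ∉ F.leaves := by simpa using h
    have := F.run_eq x y s o
    rw [F.alice_eq_zero s hs, zero_mul, zero_mul, ENNReal.toReal_eq_zero_iff] at this
    exact this.resolve_right (PMF.apply_ne_top _ _)

end Factor

/-! ### Information cost of a protocol tree -/

section TreeInfo
open Matrix
variable {V : Type} [Fintype V]

/-- The last coordinate is the one conditioned on. Its holder's factor `a s x` cancels in the
log-ratio, leaving `b s y / (M *ᵥ b s) x`. -/
theorem condMutualInfo_eq_sum {α : Type} {M : Matrix V V ℝ} (hM : IsSymmStochastic M)
    {c : ℝ} (hc : 0 < c) (L : Finset α) {a b : α → V → ℝ} (ha : ∀ s x, 0 ≤ a s x)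
    (hb : ∀ s y, 0 ≤ b s y) (hsum : ∀ x y, ∑ s ∈ L, a s x * b s y = 1)
    (P : PMF (α × V × V)) (hP : ∀ s y x, (P (s, y, x)).toReal = c * M x y * (a s x * b s y))
    (hL : ∀ s ∉ L, ∀ y x, P (s, y, x) = 0) :
    condMutualInfo P = c * (∑ s ∈ L, sideInfo M (a s) (b s)) / Real.log 2 := by
  classical
  have hF : ∀ t ∉ L ×ˢ (Finset.univ : Finset (V × V)), P t = 0 := by
    rintro ⟨s, y, x⟩ h
    exact hL s (by simpa using h) y x
  have h1 : ∀ x, (P.map (fun s => s.2.2) x).toReal = c := by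
    intro x
    rw [toReal_map_apply P _ _ hF, Finset.sum_product]
    simp only [Fintype.sum_prod_type, Finset.sum_ite_eq, Finset.mem_univ, if_true, hP]
    rw [Finset.sum_comm]
    simp only [← Finset.mul_sum, hsum, mul_one, hM.sum_eq_one]
  have h2 : ∀ s ∈ L, ∀ x, (P.map (fun s => (s.1, s.2.2)) (s, x)).toReal =
      c * (a s x * (M *ᵥ b s) x) := by
    intro s hs x
    rw [toReal_map_apply P _ _ hF, Finset.sum_product, Finset.sum_eq_single_of_mem s hs]
    · simp only [Fintype.sum_prod_type, Prod.mk.injEq, true_and, Finset.sum_ite_eq,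
        Finset.mem_univ, if_true, hP, Matrix.mulVec, dotProduct, Finset.mul_sum]
      exact Finset.sum_congr rfl fun y _ => by ring
    · intro s' _ hs'
      simp [Ne.symm hs']
  have h3 : ∀ x y, (P.map (fun s => s.2) (y, x)).toReal = c * M x y := by
    intro x y
    rw [toReal_map_apply P _ _ hF, Finset.sum_product]
    simp only [Finset.sum_ite_eq, Finset.mem_univ, if_true, hP, ← Finset.mul_sum, hsum, mul_one]
  rw [condMutualInfo, tsum_eq_sum (s := L ×ˢ Finset.univ) fun t ht => by simp [hF t ht],
    Finset.sum_product, Finset.mul_sum, Finset.sum_div]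
  refine Finset.sum_congr rfl fun s hs => ?_
  simp only [Fintype.sum_prod_type, h1, h2 s hs, h3, hP]
  rw [Finset.sum_comm, sideInfo, Finset.mul_sum, Finset.sum_div]
  refine Finset.sum_congr rfl fun x _ => ?_
  have key : ∀ y, c * M x y * (a s x * b s y) *
      Real.logb 2 (c * M x y * (a s x * b s y) / c /
        (c * (a s x * (M *ᵥ b s) x) / c * (c * M x y / c))) =
      c * a s x / Real.log 2 * (M x y * (b s y * Real.log (b s y)) -
        M x y * b s y * Real.log ((M *ᵥ b s) x)) := by
    intro y
    rcases (hM.nonneg x y).eq_or_lt with hm | hm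
    · simp [← hm]
    rcases (ha s x).eq_or_lt with ha' | ha'
    · simp [← ha']
    rcases (hb s y).eq_or_lt with hb' | hb'
    · simp [← hb']
    have h4 : 0 < (M *ᵥ b s) x := lt_of_lt_of_le (mul_pos hm hb')
      (Finset.single_le_sum (f := fun y => M x y * b s y)
        (fun y _ => mul_nonneg (hM.nonneg x y) (hb s y)) (Finset.mem_univ y))
    rw [show c * M x y * (a s x * b s y) / c / (c * (a s x * (M *ᵥ b s) x) / c * (c * M x y / c)) =
      b s y / (M *ᵥ b s) x by field_simp, Real.logb, Real.log_div hb'.ne' h4.ne']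
    ring
  rw [Finset.sum_congr rfl fun y _ => key y, ← Finset.mul_sum, Finset.sum_sub_distrib,
    ← Finset.sum_mul]
  simp only [Matrix.mulVec, dotProduct]
  ring

theorem jointLaw_apply {X Y : Type} (T : ProtocolTree X Y) (μ : PMF (X × Y)) (x : X) (y : Y)
    (s : List Bool) :
    T.jointLaw μ (x, y, s) = μ (x, y) * ((T.run x y).map Prod.fst) s := by
  rw [ProtocolTree.jointLaw, PMF.bind_apply, tsum_eq_single (x, y)]
  · rw [← map_apply_of_injective ((T.run x y).map Prod.fst) (f := fun s => (x, y, s))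
      (fun _ _ h => by simpa using h), PMF.map_comp]
    rfl
  · rintro ⟨x', y'⟩ h
    rw [map_apply_eq_zero _ fun t h' => h (by
      simp only [Prod.mk.injEq] at h' ⊢
      exact ⟨h'.1, h'.2.1⟩), mul_zero]

variable {M : Matrix V V ℝ} {c : ℝ} {μ : PMF (V × V)} {T : ProtocolTree V V}

theorem infoCost_eq_sum (hM : IsSymmStochastic M) (hc : 0 < c)
    (hμ : ∀ x y, (μ (x, y)).toReal = c * M x y) (F : Factorization T) :
    T.infoCost μ = c * (∑ s ∈ F.leaves, (sideInfo M (F.alice s) (F.bob s) +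
      sideInfo M (F.bob s) (F.alice s))) / Real.log 2 := by
  rw [ProtocolTree.infoCost,
    condMutualInfo_eq_sum hM hc F.leaves F.alice_nonneg F.bob_nonneg F.sum_eq_one,
    condMutualInfo_eq_sum hM hc F.leaves F.bob_nonneg F.alice_nonneg
      fun x y => by simp only [mul_comm, F.sum_eq_one]]
  · rw [← add_div, ← mul_add, Finset.sum_add_distrib]
  · intro s x y
    rw [show (s, x, y) = (fun s : V × V × List Bool => (s.2.2, s.1, s.2.1)) (x, y, s) from rfl,
      map_apply_of_injective _ (by
        rintro ⟨x, y, s⟩ ⟨x', y', s'⟩ h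
        simp only [Prod.mk.injEq] at h ⊢
        tauto), jointLaw_apply, ENNReal.toReal_mul, hμ, F.transcript_eq, hM.symm.apply y x]
    ring
  · intro s hs x y
    rw [show (s, x, y) = (fun s : V × V × List Bool => (s.2.2, s.1, s.2.1)) (x, y, s) from rfl,
      map_apply_of_injective _ (by
        rintro ⟨x, y, s⟩ ⟨x', y', s'⟩ h
        simp only [Prod.mk.injEq] at h ⊢
        tauto), jointLaw_apply, F.transcript_eq_zero x y hs, mul_zero]
  · intro s y x
    rw [show (s, y, x) = (fun s : V × V × List Bool => (s.2.2, s.2.1, s.1)) (x, y, s) from rfl,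
      map_apply_of_injective _ (by
        rintro ⟨x, y, s⟩ ⟨x', y', s'⟩ h
        simp only [Prod.mk.injEq] at h ⊢
        tauto), jointLaw_apply, ENNReal.toReal_mul, hμ, F.transcript_eq]
  · intro s hs y x
    rw [show (s, y, x) = (fun s : V × V × List Bool => (s.2.2, s.2.1, s.1)) (x, y, s) from rfl,
      map_apply_of_injective _ (by
        rintro ⟨x, y, s⟩ ⟨x', y', s'⟩ h
        simp only [Prod.mk.injEq] at h ⊢
        tauto), jointLaw_apply, F.transcript_eq_zero x y hs, mul_zero]

theorem sum_dotProduct_mulVec {ι : Type*} (L : Finset ι) (A : Matrix V V ℝ) (a b : ι → V → ℝ) :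
    ∑ s ∈ L, a s ⬝ᵥ A *ᵥ b s = ∑ x, ∑ y, A x y * ∑ s ∈ L, a s x * b s y := by
  simp only [dotProduct, Matrix.mulVec, Finset.mul_sum]
  rw [Finset.sum_comm]
  refine Finset.sum_congr rfl fun x _ => ?_
  rw [Finset.sum_comm]
  exact Finset.sum_congr rfl fun y _ => Finset.sum_congr rfl fun s _ => by ring

theorem Factorization.sum_dotProduct (F : Factorization T) (hM : IsSymmStochastic M)
    (hc : c * Fintype.card V = 1) : c * ∑ s ∈ F.leaves, F.alice s ⬝ᵥ M *ᵥ F.bob s = 1 := by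
  rw [sum_dotProduct_mulVec]
  simp only [F.sum_eq_one, mul_one, hM.sum_eq_one, Finset.sum_const, Finset.card_univ, nsmul_eq_mul]
  exact hc

theorem infoCost_nonneg (hM : IsSymmStochastic M) (hc : 0 < c)
    (hμ : ∀ x y, (μ (x, y)).toReal = c * M x y) : 0 ≤ T.infoCost μ := by
  obtain ⟨F⟩ := nonempty_factorization T
  rw [infoCost_eq_sum hM hc hμ F]
  exact div_nonneg (mul_nonneg hc.le (Finset.sum_nonneg fun s _ => add_nonneg
    (sideInfo_nonneg hM (F.alice_nonneg s) (F.bob_nonneg s))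
    (sideInfo_nonneg hM (F.bob_nonneg s) (F.alice_nonneg s)))) (Real.log_nonneg one_le_two)

/-- A bound independent of the tree makes the average over public coins summable; otherwise the
`tsum` defining the cost would take its default value. -/
theorem infoCost_le (hM : IsSymmStochastic M) (hc : c * Fintype.card V = 1) (hc0 : 0 < c)
    (hμ : ∀ x y, (μ (x, y)).toReal = c * M x y) :
    T.infoCost μ ≤ 2 * (∑ x, ∑ y, |Real.log (M x y)|) / Real.log 2 := by
  obtain ⟨F⟩ := nonempty_factorization T
  rw [infoCost_eq_sum hM hc0 hμ F]
  refine div_le_div_of_nonneg_right ?_ (Real.log_nonneg one_le_two)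
  set C := ∑ x, ∑ y, |Real.log (M x y)|
  calc _ ≤ c * ∑ s ∈ F.leaves, 2 * C * (F.alice s ⬝ᵥ M *ᵥ F.bob s) := by
        refine mul_le_mul_of_nonneg_left (Finset.sum_le_sum fun s _ => ?_) hc0.le
        have h1 := sideInfo_le hM (F.alice_nonneg s) (F.bob_nonneg s)
        have h2 := sideInfo_le hM (F.bob_nonneg s) (F.alice_nonneg s)
        rw [hM.dotProduct_mulVec_comm (F.bob s)] at h2
        linarith
    _ = 2 * C * (c * ∑ s ∈ F.leaves, F.alice s ⬝ᵥ M *ᵥ F.bob s) := by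
        rw [← Finset.mul_sum]; ring
    _ = _ := by rw [F.sum_dotProduct hM hc, mul_one]

/-- Announcing the output costs at most one bit. -/
theorem Factorization.sideInfo_out_le (F : Factorization T) (hM : IsSymmStochastic M)
    (s : List Bool) :
    sideInfo M (fun x => F.alice s x * F.aliceOut s true x)
        (fun y => F.bob s y * F.bobOut s true y) +
      sideInfo M (fun y => F.bob s y * F.bobOut s true y)
        (fun x => F.alice s x * F.aliceOut s true x) ≤
      sideInfo M (F.alice s) (F.bob s) + sideInfo M (F.bob s) (F.alice s) +
        Real.log 2 * (F.alice s ⬝ᵥ M *ᵥ F.bob s) := by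
  have main : ∀ {a b φ ψ : V → ℝ}, (∀ x, 0 ≤ a x) → (∀ x, 0 ≤ b x) → (∀ x, 0 ≤ φ x) →
      (∀ x, 0 ≤ ψ x) → (∀ x, φ x + ψ x = 1) →
      sideInfo M (fun x => a x * φ x) b + sideInfo M b (fun x => a x * φ x) ≤
        sideInfo M a b + sideInfo M b a + Real.log 2 * (b ⬝ᵥ M *ᵥ a) := by
    intro a b φ ψ ha hb hφ hψ hs
    have h1 := sideInfo_add_le hM ha hb hφ hψ hs
    have h2 := sideInfo_add_left (M := M) (fun x => a x * φ x) (fun x => a x * ψ x) b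
    rw [show (fun x => a x * φ x) + (fun x => a x * ψ x) = a by
      ext x; simp only [Pi.add_apply]; rw [← mul_add, hs, mul_one]] at h2
    have h3 := sideInfo_nonneg hM (fun x => mul_nonneg (ha x) (hψ x)) hb
    have h4 := sideInfo_nonneg hM hb (fun x => mul_nonneg (ha x) (hψ x))
    linarith
  rcases F.out s with ⟨h1, h2⟩ | ⟨h1, h2⟩
  · simp only [h2, mul_one]
    have := main (F.alice_nonneg s) (F.bob_nonneg s) (F.aliceOut_nonneg s true)
      (F.aliceOut_nonneg s false) h1
    rwa [hM.dotProduct_mulVec_comm (F.bob s)] at this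
  · simp only [h2, mul_one]
    have := main (F.bob_nonneg s) (F.alice_nonneg s) (F.bobOut_nonneg s true)
      (F.bobOut_nonneg s false) h1
    linarith

/-- The mean of a function of two vertices, the pair being weighted by `A`. -/
noncomputable def pairMean (c : ℝ) (A : Matrix V V ℝ) (h : V → V → ℝ) : ℝ :=
  c * ∑ x, ∑ y, A x y * h x y

theorem le_infoCost_tree [DecidableEq V] [Nonempty V] {S : Matrix V V ℝ} (hS : IsSymmStochastic S)
    {k : ℕ} (hk : 1 ≤ k) {δ : ℝ} (hδ : 0 < δ) (hδ' : δ ≤ 1 / 10 ^ 6)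
    (hc : c * Fintype.card V = 1) (hc0 : 0 < c)
    (hμ : ∀ x y, (μ (x, y)).toReal = c * (S ^ k) x y) (T : ProtocolTree V V) :
    k / 4 * Real.log (k / δ) *
      (pairMean c (S ^ k) (fun x y => (((T.run x y).map Prod.snd) true).toReal) -
        (pairMean c (S ^ (k + 2)) (fun x y => (((T.run x y).map Prod.snd) true).toReal) +
          pairMean c (lowerPow S k) (fun x y => (((T.run x y).map Prod.snd) true).toReal)) /
            (100 * δ)) ≤ Real.log 2 * (T.infoCost μ + 1) := by
  obtain ⟨F⟩ := nonempty_factorization T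
  have hM := hS.pow k
  have hlog : 0 < Real.log 2 := Real.log_pos one_lt_two
  simp only [pairMean, F.output_eq, ← sum_dotProduct_mulVec F.leaves _
    (fun s x => F.alice s x * F.aliceOut s true x) fun s y => F.bob s y * F.bobOut s true y]
  rw [infoCost_eq_sum hM hc0 hμ F, mul_add, mul_div_cancel₀ _ hlog.ne', mul_one]
  -- The leaf bound applies to the part of each leaf with output 1. The output need not be a
  -- function of the transcript, and announcing it accounts for the `+ 1` in the conclusion.
  have h1 := Finset.sum_le_sum fun s (_ : s ∈ F.leaves) =>
    (hS.leaf_bound hk hδ hδ'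
      (fun x => mul_nonneg (F.alice_nonneg s x) (F.aliceOut_nonneg s true x))
      (fun y => mul_nonneg (F.bob_nonneg s y) (F.bobOut_nonneg s true y))).trans
    (F.sideInfo_out_le hM s)
  rw [← Finset.mul_sum, Finset.sum_sub_distrib, ← Finset.sum_div, Finset.sum_add_distrib,
    Finset.sum_add_distrib, ← Finset.mul_sum] at h1
  have h2 := mul_le_mul_of_nonneg_left h1 hc0.le
  rw [mul_add, mul_left_comm c (Real.log 2), F.sum_dotProduct hM hc, mul_one] at h2
  refine le_trans (le_of_eq ?_) h2
  ring

end TreeInfo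

/-! ### The random walk on the cube -/

section Cube
open Matrix
variable {n : ℕ}

/-- Flip one coordinate. -/
def flipAt (x : Fin n → Bool) (j : Fin n) : Fin n → Bool := Function.update x j (!x j)

theorem flipAt_flipAt (x : Fin n → Bool) (j : Fin n) : flipAt (flipAt x j) j = x := by
  simp [flipAt]

theorem flipCoords_zero (x : Fin n → Bool) (i : Fin 0 → Fin n) : flipCoords x i = x := by
  ext l
  simp [flipCoords]

theorem flipCoords_cons {k : ℕ} (x : Fin n → Bool) (j : Fin n) (i : Fin k → Fin n) :
    flipCoords x (Fin.cons j i : Fin (k + 1) → Fin n) = flipCoords (flipAt x j) i := by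
  ext l
  simp only [flipCoords, Finset.card_filter, Fin.sum_univ_succ, Fin.cons_zero, Fin.cons_succ,
    flipAt]
  by_cases h : j = l
  · subst h
    rw [if_pos rfl, Function.update_self]
    generalize (∑ t, if i t = j then 1 else 0) = m
    have h : Odd (1 + m) ↔ ¬ Odd m := by rw [add_comm, Nat.odd_add_one]
    by_cases hm : Odd m <;> cases x j <;> simp [hm, h]
  · rw [if_neg h, zero_add, Function.update_of_ne (Ne.symm h)]

theorem hammingDist_flipCoords {k : ℕ} (x : Fin n → Bool) {i : Fin k → Fin n}
    (hi : Function.Injective i) : hammingDist x (flipCoords x i) = k := by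
  have h : (Finset.univ.filter fun l => x l ≠ flipCoords x i l) = Finset.univ.image i := by
    ext l
    have h1 : x l ≠ flipCoords x i l ↔ Odd (Finset.univ.filter fun t => i t = l).card := by
      rw [flipCoords]
      by_cases h : Odd (Finset.univ.filter fun t => i t = l).card <;> cases x l <;> simp [h]
    rw [Finset.mem_filter, h1]
    simp only [Finset.mem_univ, true_and, Finset.mem_image]
    constructor
    · intro h
      obtain ⟨t, ht⟩ := Finset.card_pos.1 h.pos
      exact ⟨t, by simpa using ht⟩
    · rintro ⟨t, rfl⟩
      rw [show (Finset.univ.filter fun s => i s = i t) = {t} by ext s; simp [hi.eq_iff]]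
      simp
  rw [hammingDist, h, Finset.card_image_of_injective _ hi, Finset.card_univ, Fintype.card_fin]

/-- The transition matrix of the simple random walk on the cube. -/
noncomputable def cubeWalk (n : ℕ) : Matrix (Fin n → Bool) (Fin n → Bool) ℝ :=
  Matrix.of fun x y => (n : ℝ)⁻¹ * ∑ j, if y = flipAt x j then 1 else 0

theorem cubeWalk_mulVec (h : (Fin n → Bool) → ℝ) (x : Fin n → Bool) :
    (cubeWalk n *ᵥ h) x = (n : ℝ)⁻¹ * ∑ j, h (flipAt x j) := by
  simp only [Matrix.mulVec, dotProduct, cubeWalk, Matrix.of_apply, mul_assoc, ← Finset.mul_sum,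
    Finset.sum_mul, ite_mul, one_mul, zero_mul]
  rw [Finset.sum_comm]
  simp

theorem isSymmStochastic_cubeWalk [NeZero n] : IsSymmStochastic (cubeWalk n) where
  nonneg x y := by
    rw [cubeWalk, Matrix.of_apply]
    exact mul_nonneg (by positivity) (Finset.sum_nonneg fun j _ => by split_ifs <;> norm_num)
  symm := by
    ext x y
    have h : ∀ j, (x = flipAt y j) = (y = flipAt x j) := fun j =>
      propext ⟨fun h => by rw [h, flipAt_flipAt], fun h => by rw [h, flipAt_flipAt]⟩
    simp only [Matrix.transpose_apply, cubeWalk, Matrix.of_apply, h]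
  sum_eq_one x := by
    have := cubeWalk_mulVec (fun _ => 1) x
    simp only [Matrix.mulVec, dotProduct, mul_one] at this
    rw [this]
    simp [NeZero.ne n]

theorem cubeWalk_pow_mulVec (k : ℕ) (h : (Fin n → Bool) → ℝ) (x : Fin n → Bool) :
    (cubeWalk n ^ k *ᵥ h) x = ((n : ℝ) ^ k)⁻¹ * ∑ i : Fin k → Fin n, h (flipCoords x i) := by
  induction k generalizing x with
  | zero => simp [flipCoords_zero]
  | succ k ih =>
    rw [pow_succ', ← Matrix.mulVec_mulVec, cubeWalk_mulVec, sum_fin_cons]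
    simp only [ih, flipCoords_cons, ← Finset.mul_sum]
    rw [pow_succ, mul_inv]
    ring

theorem walkPair_apply [NeZero n] (k : ℕ) (x y : Fin n → Bool) :
    (walkPair n k (x, y)).toReal =
      (Fintype.card (Fin n → Bool) : ℝ)⁻¹ * (cubeWalk n ^ k) x y := by
  have h1 : (cubeWalk n ^ k) x y =
      ((n : ℝ) ^ k)⁻¹ * ∑ i : Fin k → Fin n, if y = flipCoords x i then 1 else 0 := by
    have := cubeWalk_pow_mulVec k (fun z => if y = z then 1 else 0) x
    rw [← this]
    simp [Matrix.mulVec, dotProduct]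
  rw [walkPair, PMF.bind_apply, tsum_eq_single x]
  · rw [ENNReal.toReal_mul, PMF.uniformOfFintype_apply, ENNReal.toReal_inv, ENNReal.toReal_natCast,
      toReal_map_apply _ _ Finset.univ (by simp), h1]
    congr 1
    rw [Finset.mul_sum]
    refine Finset.sum_congr rfl fun i _ => ?_
    simp
  · intro x' hx'
    rw [map_apply_eq_zero _ fun t h => hx' (Prod.ext_iff.1 h).1, mul_zero]

/-- For `k ≤ n`, Bernoulli's inequality applied to `((n + 1 - k) / n) ^ k`, a lower bound for the
probability of distinct coordinates; for `k > n` the right side exceeds 1. -/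
theorem card_not_injective_le [NeZero n] (k : ℕ) :
    ((n : ℝ) ^ k)⁻¹ * ∑ i : Fin k → Fin n, (open Classical in if Function.Injective i then (0 : ℝ)
      else 1) ≤ k ^ 2 / n := by
  classical
  have hn : (0 : ℝ) < n := by exact_mod_cast Nat.pos_of_ne_zero (NeZero.ne n)
  have hcard : ∑ i : Fin k → Fin n, (if Function.Injective i then (0 : ℝ) else 1) =
      (n : ℝ) ^ k - n.descFactorial k := by
    have h1 : (n.descFactorial k : ℝ) =
        ∑ i : Fin k → Fin n, if Function.Injective i then (1 : ℝ) else 0 := by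
      rw [Finset.sum_boole, ← Fintype.card_subtype,
        Fintype.card_congr (Equiv.subtypeInjectiveEquivEmbedding (Fin k) (Fin n)),
        Fintype.card_embedding_eq, Fintype.card_fin, Fintype.card_fin]
    have h2 : (n : ℝ) ^ k = ∑ i : Fin k → Fin n, 1 := by simp
    rw [h1, h2, ← Finset.sum_sub_distrib]
    refine Finset.sum_congr rfl fun i _ => ?_
    split_ifs <;> norm_num
  rw [hcard, mul_sub, inv_mul_cancel₀ (by positivity)]
  rcases le_or_gt k n with hk | hk
  · have h1 : ((n + 1 - k : ℕ) : ℝ) ^ k ≤ n.descFactorial k := by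
      exact_mod_cast Nat.pow_sub_le_descFactorial n k
    have hk' : (k : ℝ) ≤ n := by exact_mod_cast hk
    rw [Nat.cast_sub (by omega)] at h1
    push_cast at h1
    have h2 := one_add_mul_le_pow (a := (1 - k : ℝ) / n) (by
      rw [le_div_iff₀ hn]
      linarith) k
    have h3 : (1 + (1 - k : ℝ) / n) ^ k = ((n : ℝ) ^ k)⁻¹ * (n + 1 - k) ^ k := by
      rw [← inv_pow, ← mul_pow]
      congr 1
      field_simp
      ring
    have h4 := mul_le_mul_of_nonneg_left h1 (show 0 ≤ ((n : ℝ) ^ k)⁻¹ by positivity)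
    have h5 : (k : ℝ) * ((1 - k) / n) = k / n - k ^ 2 / n := by ring
    have h6 : (0 : ℝ) ≤ k / n := by positivity
    linarith
  · have h1 : (1 : ℝ) ≤ k ^ 2 / n := by
      rw [le_div_iff₀ hn]
      have : (n : ℝ) ≤ k := by exact_mod_cast hk.le
      have : (1 : ℝ) ≤ k := by exact_mod_cast (show 1 ≤ k by omega)
      nlinarith
    have h2 : 0 ≤ ((n : ℝ) ^ k)⁻¹ * n.descFactorial k := by positivity
    linarith

theorem cubeWalk_pow_mulVec_le [NeZero n] (k : ℕ) {δ : ℝ} {h : (Fin n → Bool) → ℝ}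
    (h1 : ∀ y, h y ≤ 1) (x : Fin n → Bool) (hδ : 0 ≤ δ) (hx : ∀ y, hammingDist x y = k → h y ≤ δ) :
    (cubeWalk n ^ k *ᵥ h) x ≤ δ + k ^ 2 / n := by
  classical
  have hn : (n : ℝ) ≠ 0 := by exact_mod_cast NeZero.ne n
  rw [cubeWalk_pow_mulVec]
  calc _ ≤ ((n : ℝ) ^ k)⁻¹ * ∑ i : Fin k → Fin n,
        (δ + if Function.Injective i then (0 : ℝ) else 1) := by
        refine mul_le_mul_of_nonneg_left (Finset.sum_le_sum fun i _ => ?_) (by positivity)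
        split_ifs with hi
        · rw [add_zero]
          exact hx _ (hammingDist_flipCoords x hi)
        · linarith [h1 (flipCoords x i)]
    _ ≤ δ + k ^ 2 / n := by
        rw [Finset.sum_add_distrib, mul_add]
        refine add_le_add (le_of_eq ?_) (card_not_injective_le k)
        simp only [Finset.sum_const, Finset.card_univ, Fintype.card_fun, Fintype.card_fin,
          nsmul_eq_mul]
        push_cast
        field_simp

variable [NeZero n]

theorem pairMean_cubeWalk_le (k : ℕ) {δ : ℝ} {h : (Fin n → Bool) → (Fin n → Bool) → ℝ}
    (h1 : ∀ x y, h x y ≤ 1) (hδ : 0 ≤ δ) (hx : ∀ x y, hammingDist x y = k → h x y ≤ δ) :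
    pairMean (Fintype.card (Fin n → Bool) : ℝ)⁻¹ (cubeWalk n ^ k) h ≤ δ + k ^ 2 / n := by
  rw [pairMean, inv_mul_le_iff₀ (by positivity), ← nsmul_eq_mul]
  exact Finset.sum_le_card_nsmul _ _ _ fun x _ =>
    cubeWalk_pow_mulVec_le k (h1 x) x hδ (hx x)

theorem le_pairMean_cubeWalk (k : ℕ) {δ : ℝ} {h : (Fin n → Bool) → (Fin n → Bool) → ℝ}
    (h0 : ∀ x y, 0 ≤ h x y) (hδ : 0 ≤ δ) (hx : ∀ x y, hammingDist x y = k → 1 - δ ≤ h x y) :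
    1 - δ - k ^ 2 / n ≤ pairMean (Fintype.card (Fin n → Bool) : ℝ)⁻¹ (cubeWalk n ^ k) h := by
  have h1 := pairMean_cubeWalk_le (n := n) k (h := fun x y => 1 - h x y)
    (fun x y => by linarith [h0 x y]) hδ fun x y hxy => by linarith [hx x y hxy]
  have h2 : pairMean (Fintype.card (Fin n → Bool) : ℝ)⁻¹ (cubeWalk n ^ k) (fun x y => 1 - h x y) =
      1 - pairMean (Fintype.card (Fin n → Bool) : ℝ)⁻¹ (cubeWalk n ^ k) h := by
    simp only [pairMean, mul_sub, mul_one, Finset.sum_sub_distrib,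
      (isSymmStochastic_cubeWalk.pow k).sum_eq_one]
    simp
  linarith

/-! ### Randomized protocols -/

variable {X Y : Type}

theorem hasSum_toReal (P : RandomizedProtocol X Y) : HasSum (fun T => (P T).toReal) 1 := by
  have := ENNReal.hasSum_toReal (f := P) (by rw [P.tsum_coe]; exact ENNReal.one_ne_top)
  rwa [← ENNReal.tsum_toReal_eq P.apply_ne_top, P.tsum_coe, ENNReal.toReal_one] at this

theorem hasSum_output (P : RandomizedProtocol X Y) (x : X) (y : Y) (o : Bool) :
    HasSum (fun T => (P T).toReal * (((T.run x y).map Prod.snd) o).toReal)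
      (P.output x y o).toReal := by
  have h : P.output x y o = ∑' T, P T * ((T.run x y).map Prod.snd) o := by
    rw [RandomizedProtocol.output, PMF.bind_apply]
  have := ENNReal.hasSum_toReal (f := fun T => P T * ((T.run x y).map Prod.snd) o)
    (by rw [← h]; exact PMF.apply_ne_top _ _)
  rw [h, ENNReal.tsum_toReal_eq fun T =>
    ENNReal.mul_ne_top (P.apply_ne_top _) (PMF.apply_ne_top _ _)]
  simpa only [ENNReal.toReal_mul] using this

theorem hasSum_pairMean {V : Type} [Fintype V] (P : RandomizedProtocol V V) (c : ℝ)
    (A : Matrix V V ℝ) :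
    HasSum (fun T => (P T).toReal *
        pairMean c A fun x y => (((T.run x y).map Prod.snd) true).toReal)
      (pairMean c A fun x y => (P.output x y true).toReal) := by
  have h : HasSum (fun T => c * ∑ x, ∑ y, A x y *
      ((P T).toReal * (((T.run x y).map Prod.snd) true).toReal))
      (c * ∑ x, ∑ y, A x y * (P.output x y true).toReal) :=
    (hasSum_sum fun x _ => hasSum_sum fun y _ => (hasSum_output P x y true).mul_left _).mul_left _
  convert h using 1
  swap
  · rfl
  funext T
  simp only [pairMean, Finset.mul_sum]
  exact Finset.sum_congr rfl fun x _ => Finset.sum_congr rfl fun y _ => by ring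

theorem hasSum_infoCost {V : Type} [Fintype V] {M : Matrix V V ℝ} (hM : IsSymmStochastic M)
    {c : ℝ} (hc : c * Fintype.card V = 1) (hc0 : 0 < c) {μ : PMF (V × V)}
    (hμ : ∀ x y, (μ (x, y)).toReal = c * M x y) (P : RandomizedProtocol V V) :
    HasSum (fun T => (P T).toReal * T.infoCost μ) (P.infoCost μ) := by
  refine Summable.hasSum (Summable.of_nonneg_of_le
    (fun T => mul_nonneg ENNReal.toReal_nonneg (infoCost_nonneg hM hc0 hμ))
    (fun T => mul_le_mul_of_nonneg_left (infoCost_le hM hc hc0 hμ) ENNReal.toReal_nonneg)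
    ((hasSum_toReal P).summable.mul_right _))

/-- Both sides of the bound for trees are linear in the law of the tree, so it can be averaged over
the public coins. -/
theorem le_infoCost {k : ℕ} (hk : 1 ≤ k) {δ : ℝ} (hδ : 0 < δ) (hδ' : δ ≤ 1 / 10 ^ 6)
    {V : Type} [Fintype V] [DecidableEq V] [Nonempty V] {S : Matrix V V ℝ}
    (hS : IsSymmStochastic S) {c : ℝ} (hc : c * Fintype.card V = 1) (hc0 : 0 < c)
    {μ : PMF (V × V)} (hμ : ∀ x y, (μ (x, y)).toReal = c * (S ^ k) x y)
    (P : RandomizedProtocol V V) :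
    k / 4 * Real.log (k / δ) *
      (pairMean c (S ^ k) (fun x y => (P.output x y true).toReal) -
        (pairMean c (S ^ (k + 2)) (fun x y => (P.output x y true).toReal) +
          pairMean c (lowerPow S k) (fun x y => (P.output x y true).toReal)) / (100 * δ)) ≤
      Real.log 2 * (P.infoCost μ + 1) := by
  have h1 := ((hasSum_pairMean P c (S ^ k)).sub (((hasSum_pairMean P c (S ^ (k + 2))).add
    (hasSum_pairMean P c (lowerPow S k))).div_const (100 * δ))).mul_left
      (k / 4 * Real.log (k / δ))
  have h2 := ((hasSum_infoCost (hS.pow k) hc hc0 hμ P).add (hasSum_toReal P)).mul_left (Real.log 2)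
  refine hasSum_le (fun T => ?_) h1 h2
  have h3 := mul_le_mul_of_nonneg_left (le_infoCost_tree hS hk hδ hδ' hc hc0 hμ T)
    (ENNReal.toReal_nonneg (a := P T))
  refine (le_of_eq ?_).trans (h3.trans (le_of_eq ?_)) <;> ring

end Cube
end InfoCost

/-! ### The main theorem: error probabilities and constants. -/

open InfoCost

theorem mainTheorem7 :
    ∃ c δ₀ : ℝ, 0 < c ∧ 0 < δ₀ ∧
      ∀ (n k : ℕ) [NeZero n] (δ : ℝ), 1 ≤ k → 0 < δ → δ ≤ δ₀ → (k : ℝ) ^ 2 ≤ δ * n →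
        ∀ P : RandomizedProtocol (Fin n → Bool) (Fin n → Bool),
          (∀ x y : Fin n → Bool, hammingDist x y = k → 1 - δ ≤ (P.output x y true).toReal) →
          (∀ x y : Fin n → Bool, hammingDist x y + 2 = k ∨ hammingDist x y = k + 2 →
            1 - δ ≤ (P.output x y false).toReal) →
          c * (k * Real.logb 2 (k / δ)) ≤ P.infoCost (walkPair n k) := by
  refine ⟨1 / 8, 1 / 10 ^ 6, by norm_num, by norm_num, ?_⟩
  intro n k _ δ hk hδ hδ' hkn P h1 h0
  have hn : (0 : ℝ) < n := by exact_mod_cast Nat.pos_of_ne_zero (NeZero.ne n)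
  have hk1 : (1 : ℝ) ≤ k := by exact_mod_cast hk
  have hsum := fun x y => toReal_bool_add (P.output x y)
  have hle : ∀ x y, (P.output x y true).toReal ≤ 1 := fun x y => by
    linarith [hsum x y, ENNReal.toReal_nonneg (a := P.output x y false)]
  have hcard : (0 : ℝ) < Fintype.card (Fin n → Bool) := by exact_mod_cast Fintype.card_pos
  have key := le_infoCost hk hδ hδ' (isSymmStochastic_cubeWalk (n := n))
    (inv_mul_cancel₀ hcard.ne') (inv_pos.2 hcard) (walkPair_apply k) P
  have hkn' : (k : ℝ) ^ 2 / n ≤ δ := (div_le_iff₀ hn).2 hkn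
  have b1 := le_pairMean_cubeWalk (n := n) k (fun x y => ENNReal.toReal_nonneg) hδ.le h1
  have b2 := pairMean_cubeWalk_le (n := n) (k + 2) hle hδ.le fun x y hxy => by
    linarith [hsum x y, h0 x y (Or.inr hxy)]
  -- `k + 2 ≤ 3 k`, because `k ≥ 1`.
  have b2' : ((k + 2 : ℕ) : ℝ) ^ 2 / n ≤ 9 * δ := by
    rw [div_le_iff₀ hn]
    push_cast
    nlinarith
  have b3 : pairMean (Fintype.card (Fin n → Bool) : ℝ)⁻¹ (lowerPow (cubeWalk n) k)
      (fun x y => (P.output x y true).toReal) ≤ 2 * δ := by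
    rw [lowerPow]
    split_ifs with hk2
    · have := pairMean_cubeWalk_le (n := n) (k - 2) hle hδ.le fun x y hxy => by
        linarith [hsum x y, h0 x y (Or.inl (by omega))]
      have h2 : ((k - 2 : ℕ) : ℝ) ^ 2 / n ≤ k ^ 2 / n := by
        gcongr
        omega
      linarith
    · simp only [pairMean, Matrix.zero_apply, zero_mul, Finset.sum_const_zero, mul_zero]
      positivity
  set L := k / 4 * Real.log (k / δ) with hLdef
  have hlog : Real.log (10 ^ 6) ≤ Real.log (k / δ) := by
    refine Real.log_le_log (by norm_num) ?_
    rw [le_div_iff₀ hδ]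
    linarith
  have hlog2 : 8 ≤ Real.log (10 ^ 6) := by
    have h2 : Real.log (2 ^ 12) ≤ Real.log (10 ^ 6) := Real.log_le_log (by norm_num) (by norm_num)
    rw [Real.log_pow] at h2
    have := Real.log_two_gt_d9
    push_cast at h2
    linarith
  have hL : 2 ≤ L := by
    rw [hLdef, show (2 : ℝ) = 1 / 4 * 8 by norm_num]
    exact mul_le_mul (by linarith) (hlog2.trans hlog) (by norm_num) (by linarith)
  -- Output 1 has mass at least `1 - 2 δ` at length `k`, at most `10 δ` at `k + 2` and at most `2 δ`
  -- at `k - 2`, so the difference is at least `1 - 2 δ - 12 / 100`.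
  have b4 : (0.85 : ℝ) ≤ pairMean (Fintype.card (Fin n → Bool) : ℝ)⁻¹ (cubeWalk n ^ k)
        (fun x y => (P.output x y true).toReal) -
      (pairMean (Fintype.card (Fin n → Bool) : ℝ)⁻¹ (cubeWalk n ^ (k + 2))
          (fun x y => (P.output x y true).toReal) +
        pairMean (Fintype.card (Fin n → Bool) : ℝ)⁻¹ (lowerPow (cubeWalk n) k)
          (fun x y => (P.output x y true).toReal)) / (100 * δ) := by
    have h3 : (pairMean (Fintype.card (Fin n → Bool) : ℝ)⁻¹ (cubeWalk n ^ (k + 2))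
          (fun x y => (P.output x y true).toReal) +
        pairMean (Fintype.card (Fin n → Bool) : ℝ)⁻¹ (lowerPow (cubeWalk n) k)
          (fun x y => (P.output x y true).toReal)) / (100 * δ) ≤ 12 / 100 := by
      rw [div_le_iff₀ (by positivity)]
      linarith
    linarith
  have b5 := (mul_le_mul_of_nonneg_left b4 (by linarith : 0 ≤ L)).trans key
  have hl2 := Real.log_two_gt_d9
  have hl2' := Real.log_two_lt_d9
  have b6 : 1 / 8 * (k * Real.logb 2 (k / δ)) * Real.log 2 = L / 2 := by
    rw [Real.logb, hLdef]
    field_simp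
    ring
  -- What remains is `0.85 L - log 2 ≥ L / 2`: the bit spent on the output is absorbed because `L ≥
  -- 2`.
  refine le_of_mul_le_mul_right ?_ (by linarith : 0 < Real.log 2)
  rw [b6]
  linarith
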